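/- Let $\Omega\subset\mathbb R^2$ be a bounded strictly convex domain whose boundary is a simple closed $C^2$ curve $\Gamma(s)$ of length $L$, parametrized anticlockwise by arc length, and let $\mu>0$. In inverse magnetic billiards a unit-speed particle moves along straight chords inside $\Omega$ and along anticlockwise circular arcs of radius $\mu$ outside $\Omega$, with continuous velocity. Let $T:(s_0,\theta_0)\mapsto(s_2,\theta_2)$ be the map on $\mathbb R/L\mathbb Z\times(0,\pi)$ defined as follows: the particle starts at $P_0=\Gamma(s_0)$ with inward velocity making angle $\theta_0$ with the positively oriented tangent, leaves $\Omega$ at $P_1$ with its velocity making angle $\theta_1$ with the tangent, and re-enters $\Omega$ for the first time at $P_2=\Gamma(s_2)$ with its velocity making angle $\theta_2$ with the tangent. Write $\ell_1=|P_0P_1|$. In the coordinates $z=(s,u)$, $u=-\cos\theta$, let $S_2(z)=DT(T(z))\,DT(z)$ be the stability matrix. A 2-periodic orbit (an orbit of least period 2) through $z$ is called hyperbolic, parabolic or elliptic if $|\operatorname{Tr}S_2(z)|$ is $>2$, $=2$ or $<2$, respectively. Consider a 2-periodic orbit through $z=(s_0,u_0)$ with $T(s_0,\theta_0)=(s_2,\theta_2)$,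 and let $\theta_3$ be the angle between the tangent and the velocity at the exit point $P_3$ of the chord starting at $P_2$. Put $$\alpha=\frac{\ell_1}{\mu},\qquad \beta=\cot\theta_0+\cot\theta_3,\qquad \delta=\cot\theta_1+\cot\theta_2,$$ $$m=\min\{2/\beta,2/\delta\},\qquad M=\max\{2/\beta,2/\delta\}.$$ Then $T$ is differentiable at $z$ and at $T(z)$, the numbers $\alpha,\beta,\delta$ are positive, and $$\operatorname{Tr}S_2(z)=2-2\alpha(\beta+\delta)+\alpha^2\beta\delta .$$ If $\beta\neq\delta$, then the orbit is - parabolic if and only if $\alpha\in\{m,\,M,\,m+M\}$; - elliptic if and only if $\alpha\in(0,m)\cup(M,m+M)$; - hyperbolic if and only if $\alpha\in(m,M)\cup(m+M,\infty)$. If $\beta=\delta$, then $m=M$ and the orbit is - parabolic if and only if $\alpha\in\{m,\,2m\}$; - elliptic if and only if $\alpha\in(0,m)\cup(m,2m)$; - hyperbolic if and only if $\alpha\in(2m,\infty)$. -/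

import Mathlib

/-! Inverse magnetic billiards in a strictly convex planar table. The Euclidean plane is `ℂ`. -/

open Set

noncomputable section

namespace InverseMagnetic

/-- `Ω` is a bounded strictly convex planar domain whose boundary is the simple closed curve `Γ`,
of class `C²`, `L`-periodic, parametrized by arc length and traversed anticlockwise. Strict
convexity is required of the closure, since every open convex set is `StrictConvex`. -/
structure IsStrictlyConvexTable (Ω : Set ℂ) (Γ : ℝ → ℂ) (L : ℝ) : Prop where
  isOpen : IsOpen Ω
  nonempty : Ω.Nonempty
  isBounded : Bornology.IsBounded Ω
  convex : Convex ℝ Ω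
  strictConvex_closure : StrictConvex ℝ (closure Ω)
  length_pos : 0 < L
  contDiff : ContDiff ℝ 2 Γ
  periodic : Function.Periodic Γ L
  injOn : InjOn Γ (Ico 0 L)
  range_eq : range Γ = frontier Ω
  unit_speed : ∀ s, ‖deriv Γ s‖ = 1
  /-- The domain lies to the left of every oriented tangent line. -/
  anticlockwise : ∀ s, ∀ w ∈ Ω, 0 < ((starRingEnd ℂ) (deriv Γ s) * (w - Γ s)).im

/-- The unit velocity at `Γ s` making the angle `θ`, measured anticlockwise, with the tangent
`Γ' s`. It points into the table for `0 < θ < π`. -/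
def velocity (Γ : ℝ → ℂ) (s θ : ℝ) : ℂ :=
  deriv Γ s * Complex.exp (θ * Complex.I)

/-- The point reached from `P`, with initial unit velocity `v`, after turning anticlockwise through
the angle `φ` along the Larmor circle of radius `μ`, whose centre is `P + μ i v`. -/
def larmorArc (μ : ℝ) (P v : ℂ) (φ : ℝ) : ℂ :=
  (P + μ * Complex.I * v) + Complex.exp (φ * Complex.I) * (P - (P + μ * Complex.I * v))

/-- The data of one step of the motion: a chord inside the table followed by a Larmor arc
outside. -/
structure Leg where
  /-- arc length parameter of the exit point -/
  exitParam : ℝ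
  /-- length of the chord -/
  chord : ℝ
  /-- angle between the tangent and the velocity at the exit point -/
  exitAngle : ℝ
  /-- angle through which the velocity turns along the Larmor arc -/
  turn : ℝ
  /-- arc length parameter of the re-entry point -/
  reentryParam : ℝ
  /-- angle between the tangent and the velocity at the re-entry point -/
  reentryAngle : ℝ

/-- `e` describes the motion that starts at `Γ s` with the inward velocity of angle `θ`, follows
the straight chord to the exit point and then the Larmor arc up to its first return to the table.
Arc length parameters are chosen in `ℝ`, with `s < s₁ < s + L` and `s₁ < s₂ < s₁ + L`; this fixes
a lift of the motion to the universal cover of the boundary. -/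
structure IsLeg (Ω : Set ℂ) (Γ : ℝ → ℂ) (L μ s θ : ℝ) (e : Leg) : Prop where
  angle_mem : θ ∈ Ioo 0 Real.pi
  chord_pos : 0 < e.chord
  chord_inside : ∀ t ∈ Ioo 0 e.chord, Γ s + t * velocity Γ s θ ∈ Ω
  exit_mem : e.exitParam ∈ Ioo s (s + L)
  exit_eq : Γ e.exitParam = Γ s + e.chord * velocity Γ s θ
  exitAngle_eq :
    e.exitAngle = InnerProductGeometry.angle (deriv Γ e.exitParam) (velocity Γ s θ)
  turn_pos : 0 < e.turn
  arc_outside : ∀ φ ∈ Ioo 0 e.turn,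
    larmorArc μ (Γ e.exitParam) (velocity Γ s θ) φ ∉ closure Ω
  reentry_mem : e.reentryParam ∈ Ioo e.exitParam (e.exitParam + L)
  reentry_eq :
    Γ e.reentryParam = larmorArc μ (Γ e.exitParam) (velocity Γ s θ) e.turn
  reentryAngle_eq : e.reentryAngle = InnerProductGeometry.angle (deriv Γ e.reentryParam)
    (Complex.exp (e.turn * Complex.I) * velocity Γ s θ)

/-- The angle `θ ∈ [0, π]` of the phase point `z = (s, u)`, where `u = -cos θ`. -/
def phaseAngle (z : ℝ × ℝ) : ℝ := Real.arccos (-z.2)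

open Classical in
/-- The leg starting at the phase point `z = (s, u)` (a dummy value if there is none). -/
def leg (Ω : Set ℂ) (Γ : ℝ → ℂ) (L μ : ℝ) (z : ℝ × ℝ) : Leg :=
  if h : ∃ e, IsLeg Ω Γ L μ z.1 (phaseAngle z) e then h.choose else ⟨0, 0, 0, 0, 0, 0⟩

open Classical in
/-- The inverse magnetic billiard map `(s₀, u₀) ↦ (s₂, u₂)` in the coordinates `s` (arc length) and
`u = -cos θ`, lifted from the annulus `ℝ/Lℤ × (-1, 1)` to the strip `ℝ × (-1, 1)`. Points from which
there is no motion, such as those with `u = ± 1`, stay fixed. -/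
def billiardMap (Ω : Set ℂ) (Γ : ℝ → ℂ) (L μ : ℝ) (z : ℝ × ℝ) : ℝ × ℝ :=
  if ∃ e, IsLeg Ω Γ L μ z.1 (phaseAngle z) e then
    ((leg Ω Γ L μ z).reentryParam, -Real.cos (leg Ω Γ L μ z).reentryAngle)
  else z

/-- Two points of the strip represent the same point of the annulus `ℝ/Lℤ × [-1, 1]`. -/
def SamePhase (L : ℝ) (z w : ℝ × ℝ) : Prop :=
  (∃ k : ℤ, w.1 = z.1 + k * L) ∧ w.2 = z.2

/-- `z` lies in the open annulus and its orbit under the billiard map has (least) period `n`. -/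
def IsPeriodic (Ω : Set ℂ) (Γ : ℝ → ℂ) (L μ : ℝ) (n : ℕ) (z : ℝ × ℝ) : Prop :=
  z.2 ∈ Ioo (-1 : ℝ) 1 ∧ 0 < n ∧
    SamePhase L z ((billiardMap Ω Γ L μ)^[n] z) ∧
    ∀ k, 0 < k → k < n → ¬ SamePhase L z ((billiardMap Ω Γ L μ)^[k] z)

/-- The Jacobian matrix, in the coordinates `(s, u)`, of the billiard map at `z`. -/
def jacobian (Ω : Set ℂ) (Γ : ℝ → ℂ) (L μ : ℝ) (z : ℝ × ℝ) : Matrix (Fin 2) (Fin 2) ℝ :=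
  !![(fderiv ℝ (billiardMap Ω Γ L μ) z (1, 0)).1, (fderiv ℝ (billiardMap Ω Γ L μ) z (0, 1)).1;
     (fderiv ℝ (billiardMap Ω Γ L μ) z (1, 0)).2, (fderiv ℝ (billiardMap Ω Γ L μ) z (0, 1)).2]

/-- The stability matrix `Sₙ(z) = DT(Tⁿ⁻¹ z) ⋯ DT(T z) DT(z)`. -/
def stabilityMatrix (Ω : Set ℂ) (Γ : ℝ → ℂ) (L μ : ℝ) :
    ℕ → (ℝ × ℝ) → Matrix (Fin 2) (Fin 2) ℝ
  | 0, _ => 1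
  | n + 1, z =>
      jacobian Ω Γ L μ ((billiardMap Ω Γ L μ)^[n] z) * stabilityMatrix Ω Γ L μ n z

/-- The `n`-periodic orbit of `z` is hyperbolic. -/
def IsHyperbolic (Ω : Set ℂ) (Γ : ℝ → ℂ) (L μ : ℝ) (n : ℕ) (z : ℝ × ℝ) : Prop :=
  2 < |(stabilityMatrix Ω Γ L μ n z).trace|

/-- The `n`-periodic orbit of `z` is parabolic. -/
def IsParabolic (Ω : Set ℂ) (Γ : ℝ → ℂ) (L μ : ℝ) (n : ℕ) (z : ℝ × ℝ) : Prop :=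
  |(stabilityMatrix Ω Γ L μ n z).trace| = 2

/-- The `n`-periodic orbit of `z` is elliptic. -/
def IsElliptic (Ω : Set ℂ) (Γ : ℝ → ℂ) (L μ : ℝ) (n : ℕ) (z : ℝ × ℝ) : Prop :=
  |(stabilityMatrix Ω Γ L μ n z).trace| < 2

/-- At a point moved by the billiard map, `leg` is a genuine leg of the motion. In particular this
holds at every point of a periodic orbit of least period at least two. -/
theorem isLeg_leg_of_ne {Ω : Set ℂ} {Γ : ℝ → ℂ} {L μ : ℝ} {z : ℝ × ℝ}
    (h : billiardMap Ω Γ L μ z ≠ z) :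
    IsLeg Ω Γ L μ z.1 (phaseAngle z) (leg Ω Γ L μ z) := by
  by_cases hz : ∃ e, IsLeg Ω Γ L μ z.1 (phaseAngle z) e
  · rw [leg, dif_pos hz]
    exact hz.choose_spec
  · exact absurd (if_neg hz) h

end InverseMagnetic

end

/-!
# Two-periodic orbits of inverse magnetic billiards

Along an orbit of least period two the velocity and the position close up after two chords and two
Larmor arcs. A Larmor arc from the velocity `v` to the velocity `v'` moves the particle by
`μ i (v - v')`, so the displacements along the two arcs cancel, hence so do the two chords: they are
antiparallel of the same length `ℓ`, and both arcs are half circles (`closing_condition`). The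
diameter of each half circle joins two boundary points, so it lies on the inner side of the tangents
at its ends; as it is perpendicular to the velocity, the exit and re-entry angles are acute and
their cotangents positive (`IsLeg.cot_pos_of_half_turn`).

Differentiability. Every point of the orbit has a leg, so all re-entry angles lie strictly between
`0` and `π`. A transversal re-entry is directed inwards (`IsLeg.reentry_im_pos`), because a curve
that leaves a boundary point strictly to the left of the tangent enters the table at once
(`IsStrictlyConvexTable.eventually_mem`). The exit is transversal by convexity. Two applications of
the implicit function theorem solve the equations for the exit point and for the re-entry point
(`exists_local_solution`), and these solutions are true legs nearby (`eventually_isLeg`): the arc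
cannot meet the table shortly after the exit or shortly before the re-entry, by an explicit formula
for its distance to the tangent, nor in between, by compactness.

The trace. A variation of the motion is described by the displacement `y` perpendicular to the
velocity and the rotation `η` of the velocity. The chord acts by `y ↦ y + ℓ η`; the half circle
sends `(y, η)` to `(-y, c y - η)`, where `μ c` is the sum of the cotangents of the exit and the
re-entry angle. The curvature of the boundary enters only through the passage from `(ds, du)` to
`(y, η)` (`differentiableAt_and_transversalFrame_mul_jacobian`), and this passage cancels from the
trace over a closed orbit (`trace_mul_of_frames`). What remains is the trace `t` of a product of two
explicit matrices, and the classification follows from the factorizations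
`t - 2 = α (α β δ - 2 (β + δ))` and `t + 2 = (α β - 2) (α δ - 2)` (`trace_trichotomy`).
-/

open Set

noncomputable section

namespace InverseMagnetic

open Filter Topology ComplexConjugate

/-! ### Angles between unit vectors of the complex plane -/

lemma cos_angle_of_norm_eq_one {a v : ℂ} (ha : ‖a‖ = 1) (hv : ‖v‖ = 1) :
    Real.cos (InnerProductGeometry.angle a v) = (conj a * v).re := by
  rw [InnerProductGeometry.cos_angle, ha, hv, Complex.inner, mul_comm v]
  simp

lemma sin_angle_of_norm_eq_one {a v : ℂ} (ha : ‖a‖ = 1) (hv : ‖v‖ = 1) :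
    Real.sin (InnerProductGeometry.angle a v) = |(conj a * v).im| := by
  have h1 := Real.sin_sq_add_cos_sq (InnerProductGeometry.angle a v)
  rw [cos_angle_of_norm_eq_one ha hv] at h1
  have h2 : ‖conj a * v‖ ^ 2 = 1 := by simp [ha, hv]
  rw [← Complex.normSq_eq_norm_sq, Complex.normSq_apply] at h2
  have h3 : Real.sin (InnerProductGeometry.angle a v) ^ 2 = (conj a * v).im ^ 2 := by nlinarith
  rw [← abs_of_nonneg (InnerProductGeometry.sin_angle_nonneg a v)]
  exact (sq_eq_sq_iff_abs_eq_abs _ _).1 h3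

lemma mul_conj_mul_of_norm_eq_one {a : ℂ} (ha : ‖a‖ = 1) (v : ℂ) : a * (conj a * v) = v := by
  rw [← mul_assoc, Complex.mul_conj, Complex.normSq_eq_norm_sq, ha]
  simp

/-- A unit vector `v` on the left of the unit vector `a` is `a` turned anticlockwise through the
(unsigned) angle between them. -/
lemma eq_mul_exp_angle {a v : ℂ} (ha : ‖a‖ = 1) (hv : ‖v‖ = 1) (h : 0 < (conj a * v).im) :
    v = a * Complex.exp (InnerProductGeometry.angle a v * Complex.I) := by
  have : Complex.exp (InnerProductGeometry.angle a v * Complex.I) = conj a * v := by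
    apply Complex.ext
    · rw [Complex.exp_ofReal_mul_I_re, cos_angle_of_norm_eq_one ha hv]
    · rw [Complex.exp_ofReal_mul_I_im, sin_angle_of_norm_eq_one ha hv, abs_of_pos h]
  rw [this, mul_conj_mul_of_norm_eq_one ha]

/-- A unit vector `v` on the right of the unit vector `a` is `a` turned clockwise through the
(unsigned) angle between them. -/
lemma eq_mul_exp_neg_angle {a v : ℂ} (ha : ‖a‖ = 1) (hv : ‖v‖ = 1) (h : (conj a * v).im < 0) :
    v = a * Complex.exp (-InnerProductGeometry.angle a v * Complex.I) := by
  have : Complex.exp (((-InnerProductGeometry.angle a v : ℝ) : ℂ) * Complex.I) = conj a * v := by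
    apply Complex.ext
    · rw [Complex.exp_ofReal_mul_I_re, Real.cos_neg, cos_angle_of_norm_eq_one ha hv]
    · rw [Complex.exp_ofReal_mul_I_im, Real.sin_neg, sin_angle_of_norm_eq_one ha hv,
        abs_of_neg h, neg_neg]
  rw [← Complex.ofReal_neg, this, mul_conj_mul_of_norm_eq_one ha]

lemma angle_mem_Ioo_iff {a v : ℂ} (ha : ‖a‖ = 1) (hv : ‖v‖ = 1) :
    InnerProductGeometry.angle a v ∈ Ioo 0 Real.pi ↔ (conj a * v).im ≠ 0 := by
  rw [← abs_pos, ← sin_angle_of_norm_eq_one ha hv]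
  refine ⟨fun h => Real.sin_pos_of_mem_Ioo h, fun h => ⟨?_, ?_⟩⟩
  · refine (InnerProductGeometry.angle_nonneg a v).lt_of_ne fun h0 => ?_
    rw [← h0] at h
    simp at h
  · refine (InnerProductGeometry.angle_le_pi a v).lt_of_ne fun h0 => ?_
    rw [h0] at h
    simp at h

lemma norm_velocity {Ω : Set ℂ} {Γ : ℝ → ℂ} {L : ℝ} (hΩ : IsStrictlyConvexTable Ω Γ L) (s θ : ℝ) :
    ‖velocity Γ s θ‖ = 1 := by
  rw [velocity, norm_mul, hΩ.unit_speed, Complex.norm_exp_ofReal_mul_I, one_mul]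

lemma phaseAngle_mem_Ioo_iff {z : ℝ × ℝ} : phaseAngle z ∈ Ioo 0 Real.pi ↔ z.2 ∈ Ioo (-1 : ℝ) 1 := by
  rw [phaseAngle, mem_Ioo, mem_Ioo, Real.arccos_pos, ← Real.arccos_neg_one]
  constructor
  · rintro ⟨h1, h2⟩
    refine ⟨by linarith, ?_⟩
    by_contra h
    have : Real.arccos (-z.2) = Real.arccos (-1) := by
      rw [Real.arccos_neg_one, Real.arccos_of_le_neg_one (by linarith)]
    linarith
  · rintro ⟨h1, h2⟩
    exact ⟨by linarith, Real.strictAntiOn_arccos (by simp) ⟨by linarith, by linarith⟩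
      (by linarith)⟩

/-- Turning through `φ` along the Larmor circle moves the point by the chord of length
`2 μ sin (φ / 2)`, whose direction is the mean of the initial and the final direction. -/
lemma larmorArc_sub (μ : ℝ) (P v : ℂ) (φ : ℝ) :
    larmorArc μ P v φ - P = ((2 * μ * Real.sin (φ / 2) : ℝ) : ℂ) *
      (v * Complex.exp ((φ / 2 : ℝ) * Complex.I)) := by
  have h : Complex.exp (φ * Complex.I)
      = Complex.exp ((φ / 2 : ℝ) * Complex.I) * Complex.exp ((φ / 2 : ℝ) * Complex.I) := by
    rw [← Complex.exp_add]; congr 1; push_cast; ring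
  have h2 : Complex.exp ((φ / 2 : ℝ) * Complex.I)
      = Real.cos (φ / 2) + Real.sin (φ / 2) * Complex.I := by
    rw [Complex.exp_mul_I, Complex.ofReal_cos, Complex.ofReal_sin]
  have h3 : (Real.cos (φ / 2) : ℂ) ^ 2 + (Real.sin (φ / 2) : ℂ) ^ 2 = 1 := by
    exact_mod_cast Real.cos_sq_add_sin_sq _
  rw [larmorArc, h, h2]
  rw [Complex.ofReal_mul, Complex.ofReal_mul]
  generalize (Real.cos (φ / 2) : ℂ) = c at *
  generalize (Real.sin (φ / 2) : ℂ) = d at *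
  push_cast
  linear_combination (-(μ * Complex.I * v)) * h3 + (μ * v * (-2 * c * d - d ^ 2 * Complex.I)) *
    Complex.I_sq

/-! ### The table and its supporting lines -/

namespace IsStrictlyConvexTable

variable {Ω : Set ℂ} {Γ : ℝ → ℂ} {L : ℝ}

lemma exists_int_of_eq (hΩ : IsStrictlyConvexTable Ω Γ L) {s t : ℝ} (h : Γ s = Γ t) :
    ∃ k : ℤ, t = s + k * L := by
  have hm : ∀ x, Γ (toIcoMod hΩ.length_pos 0 x) = Γ x := fun x => by
    rw [toIcoMod, hΩ.periodic.sub_zsmul_eq]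
  have hI : ∀ x, toIcoMod hΩ.length_pos 0 x ∈ Ico 0 L := fun x => by
    simpa using toIcoMod_mem_Ico hΩ.length_pos 0 x
  have := hΩ.injOn (hI s) (hI t) (by rw [hm, hm, h])
  refine ⟨toIcoDiv hΩ.length_pos 0 t - toIcoDiv hΩ.length_pos 0 s, ?_⟩
  rw [toIcoMod, toIcoMod, zsmul_eq_mul, zsmul_eq_mul] at this
  push_cast
  linarith

lemma injOn_Ioo (hΩ : IsStrictlyConvexTable Ω Γ L) (a : ℝ) : InjOn Γ (Ioo a (a + L)) := by
  intro s hs t ht h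
  obtain ⟨k, rfl⟩ := hΩ.exists_int_of_eq h
  have hL := hΩ.length_pos
  have h1 : (k : ℝ) * L < 1 * L := by linarith [hs.1, ht.2]
  have h2 : (-1 : ℝ) * L < k * L := by linarith [hs.2, ht.1]
  have h3 : k < 1 := by exact_mod_cast lt_of_mul_lt_mul_right h1 hL.le
  have h4 : -1 < k := by exact_mod_cast lt_of_mul_lt_mul_right h2 hL.le
  have : k = 0 := by omega
  simp [this]

lemma ne_of_mem_Ioo (hΩ : IsStrictlyConvexTable Ω Γ L) {a t : ℝ} (ht : t ∈ Ioo a (a + L)) :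
    Γ a ≠ Γ t := by
  intro h
  obtain ⟨k, rfl⟩ := hΩ.exists_int_of_eq h
  have hL := hΩ.length_pos
  have h1 : (k : ℝ) * L < 1 * L := by linarith [ht.2]
  have h2 : (0 : ℝ) * L < k * L := by linarith [ht.1]
  have h3 : k < 1 := by exact_mod_cast lt_of_mul_lt_mul_right h1 hL.le
  have h4 : 0 < k := by exact_mod_cast lt_of_mul_lt_mul_right h2 hL.le
  omega

lemma deriv_periodic (hΩ : IsStrictlyConvexTable Ω Γ L) : Function.Periodic (deriv Γ) L := by
  intro s
  rw [← deriv_comp_add_const]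
  exact congrArg (fun f => deriv f s) (funext hΩ.periodic)

lemma differentiable (hΩ : IsStrictlyConvexTable Ω Γ L) : Differentiable ℝ Γ :=
  hΩ.contDiff.differentiable (by norm_num)

lemma contDiff_deriv (hΩ : IsStrictlyConvexTable Ω Γ L) : ContDiff ℝ 1 (deriv Γ) :=
  ((contDiff_succ_iff_deriv (n := 1)).1 hΩ.contDiff).2.2

lemma mem_frontier (hΩ : IsStrictlyConvexTable Ω Γ L) (s : ℝ) : Γ s ∈ frontier Ω :=
  hΩ.range_eq ▸ mem_range_self s

lemma mem_closure (hΩ : IsStrictlyConvexTable Ω Γ L) (s : ℝ) : Γ s ∈ closure Ω :=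
  frontier_subset_closure (hΩ.mem_frontier s)

lemma notMem (hΩ : IsStrictlyConvexTable Ω Γ L) (s : ℝ) : Γ s ∉ Ω := fun h =>
  hΩ.isOpen.inter_frontier_eq.subset ⟨h, hΩ.mem_frontier s⟩

lemma im_nonneg (hΩ : IsStrictlyConvexTable Ω Γ L) (s : ℝ) {w : ℂ} (hw : w ∈ closure Ω) :
    0 ≤ (conj (deriv Γ s) * (w - Γ s)).im := by
  have hc : IsClosed {w : ℂ | 0 ≤ (conj (deriv Γ s) * (w - Γ s)).im} :=
    isClosed_le continuous_const (by fun_prop)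
  exact closure_minimal (fun w hw => (hΩ.anticlockwise s w hw).le) hc hw

lemma openSegment_subset (hΩ : IsStrictlyConvexTable Ω Γ L) {p q : ℂ} (hp : p ∈ closure Ω)
    (hq : q ∈ closure Ω) (hpq : p ≠ q) : openSegment ℝ p q ⊆ Ω := by
  have h := hΩ.strictConvex_closure.openSegment_subset hp hq hpq
  rwa [hΩ.convex.interior_closure_eq_interior_of_nonempty_interior
    (by rw [hΩ.isOpen.interior_eq]; exact hΩ.nonempty), hΩ.isOpen.interior_eq] at h

lemma im_pos_of_ne (hΩ : IsStrictlyConvexTable Ω Γ L) {s t : ℝ} (h : Γ s ≠ Γ t) :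
    0 < (conj (deriv Γ s) * (Γ t - Γ s)).im := by
  have hm := hΩ.openSegment_subset (hΩ.mem_closure s) (hΩ.mem_closure t) h
    (show (1 / 2 : ℝ) • Γ s + (1 / 2 : ℝ) • Γ t ∈ openSegment ℝ (Γ s) (Γ t) from
      ⟨1 / 2, 1 / 2, by norm_num, by norm_num, by norm_num, rfl⟩)
  have h1 := hΩ.anticlockwise s _ hm
  have h2 : conj (deriv Γ s) * ((1 / 2 : ℝ) • Γ s + (1 / 2 : ℝ) • Γ t - Γ s)
      = ((1 / 2 : ℝ) : ℂ) * (conj (deriv Γ s) * (Γ t - Γ s)) := by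
    simp only [Complex.real_smul]; push_cast; ring
  rw [h2, Complex.im_ofReal_mul] at h1
  linarith

/-- A curve that starts at a boundary point with a velocity pointing strictly to the left of the
tangent line lies in the open table for small positive times. -/
lemma eventually_mem (hΩ : IsStrictlyConvexTable Ω Γ L) {s : ℝ} {γ : ℝ → ℂ} {d : ℂ}
    (hγ : HasDerivAt γ d 0) (h0 : γ 0 = Γ s) (hd : 0 < (conj (deriv Γ s) * d).im) :
    ∀ᶠ t in 𝓝[>] (0 : ℝ), γ t ∈ Ω := by
  obtain ⟨c, hc⟩ := hΩ.nonempty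
  have hc' := hΩ.anticlockwise s c hc
  have ha : ‖deriv Γ s‖ = 1 := hΩ.unit_speed s
  set v := deriv Γ s with hv
  -- `d` is a combination of the tangent vector and of the direction to an interior point,
  -- the latter with a positive coefficient
  obtain ⟨a, b, hb, hab⟩ : ∃ a b : ℝ, 0 < b ∧ d = a * v + b * (c - Γ s) := by
    refine ⟨(conj v * d).re - (conj v * d).im / (conj v * (c - Γ s)).im *
      (conj v * (c - Γ s)).re, (conj v * d).im / (conj v * (c - Γ s)).im, div_pos hd hc', ?_⟩
    have h1 := mul_conj_mul_of_norm_eq_one ha d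
    have h2 := mul_conj_mul_of_norm_eq_one ha (c - Γ s)
    generalize conj v * d = D at *
    generalize conj v * (c - Γ s) = C at *
    have : D = ((D.re - D.im / C.im * C.re : ℝ) : ℂ) + ((D.im / C.im : ℝ) : ℂ) * C := by
      apply Complex.ext
      · simp
      · simp only [Complex.add_im, Complex.ofReal_im, Complex.im_ofReal_mul]
        field_simp
        ring
    linear_combination v * this - h1 + ((D.im / C.im : ℝ) : ℂ) * h2
  -- the point of which `γ t` is the convex combination with `Γ (s + t * a)`
  let q : ℝ → ℂ := fun t => (t⁻¹ * b⁻¹ : ℝ) • (γ t - γ 0) -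
    (t⁻¹ * b⁻¹ : ℝ) • (Γ (s + t * a) - Γ (s + 0 * a)) + Γ (s + t * a)
  have hΓd : HasDerivAt (fun t : ℝ => Γ (s + t * a)) (a • v) 0 := by
    have h1 : HasDerivAt (fun t : ℝ => s + t * a) a 0 := by
      simpa using ((hasDerivAt_id (0 : ℝ)).mul_const a).const_add s
    have h2 : HasDerivAt Γ v (s + 0 * a) := by
      simpa [hv] using (hΩ.differentiable s).hasDerivAt
    exact h2.scomp 0 h1
  have hlim : Tendsto q (𝓝[>] 0) (𝓝 (b⁻¹ • d - b⁻¹ • (a • v) + Γ s)) := by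
    have hs : ∀ {f : ℝ → ℂ} {f' : ℂ}, HasDerivAt f f' 0 →
        Tendsto (fun t : ℝ => (t⁻¹ * b⁻¹ : ℝ) • (f t - f 0)) (𝓝[>] 0) (𝓝 (b⁻¹ • f')) := by
      intro f f' hf
      have := (hasDerivAt_iff_tendsto_slope.1 hf).mono_left
        (nhdsWithin_mono 0 (fun x (hx : 0 < x) => hx.ne') : 𝓝[>] (0 : ℝ) ≤ 𝓝[≠] 0)
      refine (this.const_smul b⁻¹).congr fun t => ?_
      rw [slope_def_module, sub_zero, smul_smul, mul_comm]
    refine ((hs hγ).sub (hs hΓd)).add ?_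
    have := hΓd.continuousAt.tendsto.mono_left (nhdsWithin_le_nhds (s := Ioi (0 : ℝ)))
    simpa using this
  have hval : b⁻¹ • d - b⁻¹ • (a • v) + Γ s = c := by
    rw [hab]
    simp only [Complex.real_smul]
    have : (b : ℂ) ≠ 0 := by exact_mod_cast hb.ne'
    push_cast
    field_simp
    ring
  rw [hval] at hlim
  have hev := hlim.eventually (hΩ.isOpen.mem_nhds hc)
  have hsm : ∀ᶠ t in 𝓝[>] (0 : ℝ), t * b < 1 := by
    have : Tendsto (fun t : ℝ => t * b) (𝓝 0) (𝓝 (0 * b)) :=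
      (continuous_id.mul continuous_const).tendsto 0
    rw [zero_mul] at this
    exact (this.mono_left nhdsWithin_le_nhds).eventually (gt_mem_nhds one_pos)
  filter_upwards [hev, hsm, self_mem_nhdsWithin] with t ht htb (ht0 : 0 < t)
  have hseg := hΩ.convex.combo_closure_interior_mem_interior (hΩ.mem_closure (s + t * a))
    (by rwa [hΩ.isOpen.interior_eq] : q t ∈ interior Ω)
    (by linarith : 0 ≤ 1 - t * b) (mul_pos ht0 hb) (by ring)
  rw [hΩ.isOpen.interior_eq] at hseg
  convert hseg using 1
  simp only [q, h0, zero_mul, add_zero, Complex.real_smul]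
  have h1 : (b : ℂ) ≠ 0 := by exact_mod_cast hb.ne'
  have h2 : (t : ℂ) ≠ 0 := by exact_mod_cast ht0.ne'
  push_cast
  field_simp
  ring

end IsStrictlyConvexTable

/-! ### Transversality and uniqueness of legs -/

lemma larmorArc_eq (μ : ℝ) (P v : ℂ) (φ : ℝ) : larmorArc μ P v φ =
    P + μ * Complex.I * (v - Complex.exp (φ * Complex.I) * v) := by
  rw [larmorArc]; ring

lemma larmorArc_larmorArc (μ : ℝ) (P v : ℂ) (φ ψ : ℝ) :
    larmorArc μ (larmorArc μ P v φ) (Complex.exp (φ * Complex.I) * v) ψ =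
      larmorArc μ P v (φ + ψ) := by
  simp only [larmorArc_eq]
  push_cast
  rw [add_mul, Complex.exp_add]
  ring

lemma hasDerivAt_larmorArc (μ : ℝ) (P v : ℂ) (φ : ℝ) :
    HasDerivAt (larmorArc μ P v) (μ * (Complex.exp (φ * Complex.I) * v)) φ := by
  have h1 : HasDerivAt (fun t : ℝ => (t : ℂ) * Complex.I) Complex.I φ := by
    simpa using (hasDerivAt_id φ).ofReal_comp.mul_const Complex.I
  have h2 := (((h1.cexp.mul_const v).const_sub v).const_mul (μ * Complex.I)).const_add P
  rw [funext (larmorArc_eq μ P v)]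
  refine h2.congr_deriv ?_
  linear_combination (-μ * Complex.exp (φ * Complex.I) * v) * Complex.I_sq

/-- The signed distance to the line through `P` of direction `a`, along a Larmor arc that starts
at `P` at the angle `χ` with `a`. -/
lemma im_conj_mul_larmorArc_sub {a : ℂ} (ha : ‖a‖ = 1) (μ : ℝ) (P : ℂ) (χ φ : ℝ) :
    (conj a * (larmorArc μ P (a * Complex.exp (χ * Complex.I)) φ - P)).im =
      2 * μ * Real.sin (φ / 2) * Real.sin (χ + φ / 2) := by
  have h1 : conj a * a = 1 := by
    rw [mul_comm, Complex.mul_conj, Complex.normSq_eq_norm_sq, ha]; simp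
  have h2 : conj a * (larmorArc μ P (a * Complex.exp (χ * Complex.I)) φ - P) =
      ((2 * μ * Real.sin (φ / 2) : ℝ) : ℂ) *
        Complex.exp (((χ + φ / 2 : ℝ) : ℂ) * Complex.I) := by
    rw [larmorArc_sub, Complex.ofReal_add, add_mul, Complex.exp_add]
    linear_combination ((2 * μ * Real.sin (φ / 2) : ℝ) : ℂ) * Complex.exp (χ * Complex.I) *
      Complex.exp ((φ / 2 : ℝ) * Complex.I) * h1
  rw [h2, Complex.im_ofReal_mul, Complex.exp_ofReal_mul_I_im]

namespace IsStrictlyConvexTable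

variable {Ω : Set ℂ} {Γ : ℝ → ℂ} {L μ : ℝ}

/-- A Larmor arc that leaves a boundary point transversally outwards at the angle `θ` stays outside
the table while it turns through less than `2 θ`. -/
lemma larmorArc_notMem_of_exit (hΩ : IsStrictlyConvexTable Ω Γ L) (hμ : 0 < μ) {s : ℝ} {v : ℂ}
    (hv : ‖v‖ = 1) (hs : (conj (deriv Γ s) * v).im < 0) {φ : ℝ} (h0 : 0 < φ)
    (hφ : φ < 2 * InnerProductGeometry.angle (deriv Γ s) v) :
    larmorArc μ (Γ s) v φ ∉ closure Ω := by
  intro hmem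
  have h1 := hΩ.im_nonneg s hmem
  have h2 := (angle_mem_Ioo_iff (hΩ.unit_speed s) hv).2 hs.ne
  have h3 := eq_mul_exp_neg_angle (hΩ.unit_speed s) hv hs
  set χ := InnerProductGeometry.angle (deriv Γ s) v
  rw [h3, ← Complex.ofReal_neg, im_conj_mul_larmorArc_sub (hΩ.unit_speed s)] at h1
  have h4 : 0 < Real.sin (φ / 2) :=
    Real.sin_pos_of_pos_of_lt_pi (by linarith) (by linarith [h2.2])
  have h5 : Real.sin (-χ + φ / 2) < 0 :=
    Real.sin_neg_of_neg_of_neg_pi_lt (by linarith) (by linarith [h2.2])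
  have h6 : 0 < 2 * μ * Real.sin (φ / 2) := by positivity
  nlinarith

/-- A Larmor arc that arrives at a boundary point transversally inwards at the angle `θ` was outside
the table while it turned through the last `2 θ`. -/
lemma larmorArc_notMem_of_reentry (hΩ : IsStrictlyConvexTable Ω Γ L) (hμ : 0 < μ) {s : ℝ}
    {P v : ℂ} (hv : ‖v‖ = 1) {φ : ℝ} (hP : Γ s = larmorArc μ P v φ)
    (hs : 0 < (conj (deriv Γ s) * (Complex.exp (φ * Complex.I) * v)).im) {ψ : ℝ} (hψ : ψ < φ)
    (h0 : φ - 2 * InnerProductGeometry.angle (deriv Γ s) (Complex.exp (φ * Complex.I) * v) < ψ) :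
    larmorArc μ P v ψ ∉ closure Ω := by
  intro hmem
  have hw : ‖Complex.exp (φ * Complex.I) * v‖ = 1 := by
    rw [norm_mul, Complex.norm_exp_ofReal_mul_I, hv, one_mul]
  rw [(by ring : ψ = φ + (ψ - φ)), ← larmorArc_larmorArc, ← hP] at hmem
  have h1 := hΩ.im_nonneg s hmem
  have h2 := (angle_mem_Ioo_iff (hΩ.unit_speed s) hw).2 hs.ne'
  have h3 := eq_mul_exp_angle (hΩ.unit_speed s) hw hs
  set χ := InnerProductGeometry.angle (deriv Γ s) (Complex.exp (φ * Complex.I) * v)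
  rw [h3, im_conj_mul_larmorArc_sub (hΩ.unit_speed s)] at h1
  have h4 : Real.sin ((ψ - φ) / 2) < 0 :=
    Real.sin_neg_of_neg_of_neg_pi_lt (by linarith) (by linarith [h2.2])
  have h5 : 0 < Real.sin (χ + (ψ - φ) / 2) :=
    Real.sin_pos_of_pos_of_lt_pi (by linarith) (by linarith [h2.2])
  have h6 : 2 * μ * Real.sin ((ψ - φ) / 2) < 0 := mul_neg_of_pos_of_neg (by positivity) h4
  nlinarith

end IsStrictlyConvexTable

namespace IsLeg

variable {Ω : Set ℂ} {Γ : ℝ → ℂ} {L μ s θ : ℝ} {e e' : Leg}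

lemma norm_reentryVelocity (hΩ : IsStrictlyConvexTable Ω Γ L) (φ : ℝ) :
    ‖Complex.exp (φ * Complex.I) * velocity Γ s θ‖ = 1 := by
  rw [norm_mul, Complex.norm_exp_ofReal_mul_I, norm_velocity hΩ, one_mul]

lemma exit_im_neg (hΩ : IsStrictlyConvexTable Ω Γ L) (he : IsLeg Ω Γ L μ s θ e) :
    (conj (deriv Γ e.exitParam) * velocity Γ s θ).im < 0 := by
  have h0 := he.chord_pos
  have h1 := hΩ.anticlockwise e.exitParam _
    (he.chord_inside (e.chord / 2) ⟨by linarith, by linarith⟩)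
  have h2 : conj (deriv Γ e.exitParam) * (Γ s + ((e.chord / 2 : ℝ) : ℂ) * velocity Γ s θ -
      Γ e.exitParam) = ((-(e.chord / 2) : ℝ) : ℂ) *
        (conj (deriv Γ e.exitParam) * velocity Γ s θ) := by
    rw [he.exit_eq]; push_cast; ring
  rw [h2, Complex.im_ofReal_mul] at h1
  nlinarith

/-- A transversal re-entry is directed inwards: otherwise the arc would already be inside the table
just before it arrives. -/
lemma reentry_im_pos (hΩ : IsStrictlyConvexTable Ω Γ L) (he : IsLeg Ω Γ L μ s θ e) (hμ : 0 < μ)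
    (h : e.reentryAngle ∈ Ioo 0 Real.pi) :
    0 < (conj (deriv Γ e.reentryParam) *
      (Complex.exp (e.turn * Complex.I) * velocity Γ s θ)).im := by
  rw [he.reentryAngle_eq, angle_mem_Ioo_iff (hΩ.unit_speed _) (norm_reentryVelocity hΩ _)] at h
  by_contra hcon
  have hneg := lt_of_le_of_ne (not_lt.1 hcon) h
  set v := velocity Γ s θ
  -- the arc traversed backwards from the re-entry point
  have hder : HasDerivAt (fun t : ℝ => larmorArc μ (Γ e.exitParam) v (e.turn - t))
      (-(μ * (Complex.exp (e.turn * Complex.I) * v))) 0 := by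
    have h1 : HasDerivAt (fun t : ℝ => e.turn - t) (-1) 0 := by
      simpa using (hasDerivAt_id (0 : ℝ)).const_sub e.turn
    have h2 := hasDerivAt_larmorArc μ (Γ e.exitParam) v (e.turn - 0)
    exact (h2.scomp 0 h1).congr_deriv (by simp)
  have hev := hΩ.eventually_mem (s := e.reentryParam) hder
    (by simp only [sub_zero]; exact he.reentry_eq.symm) (by
      rw [mul_neg, Complex.neg_im, mul_left_comm, Complex.im_ofReal_mul]
      nlinarith)
  have hlt : ∀ᶠ t in 𝓝[>] (0 : ℝ), t < e.turn :=
    (gt_mem_nhds he.turn_pos).filter_mono nhdsWithin_le_nhds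
  obtain ⟨t, ⟨ht1, ht2⟩, ht3⟩ := ((hev.and hlt).and self_mem_nhdsWithin).exists
  have ht3' : 0 < t := ht3
  exact he.arc_outside (e.turn - t) ⟨by linarith, by linarith⟩ (subset_closure ht1)

lemma reentryAngle_mem_Ioo_iff (he : IsLeg Ω Γ L μ s θ e) :
    e.reentryAngle ∈ Ioo 0 Real.pi ↔ -Real.cos e.reentryAngle ∈ Ioo (-1 : ℝ) 1 := by
  have : phaseAngle (0, -Real.cos e.reentryAngle) = e.reentryAngle := by
    rw [phaseAngle, neg_neg, he.reentryAngle_eq]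
    exact Real.arccos_cos (InnerProductGeometry.angle_nonneg _ _)
      (InnerProductGeometry.angle_le_pi _ _)
  rw [← phaseAngle_mem_Ioo_iff (z := (0, -Real.cos e.reentryAngle)), this]

lemma chord_le (hΩ : IsStrictlyConvexTable Ω Γ L) (he : IsLeg Ω Γ L μ s θ e)
    (he' : IsLeg Ω Γ L μ s θ e') : e.chord ≤ e'.chord := by
  by_contra h
  have := he.chord_inside e'.chord ⟨he'.chord_pos, not_le.1 h⟩
  rw [← he'.exit_eq] at this
  exact hΩ.notMem _ this

lemma exitParam_eq (hΩ : IsStrictlyConvexTable Ω Γ L) (he : IsLeg Ω Γ L μ s θ e)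
    (he' : IsLeg Ω Γ L μ s θ e') : e.exitParam = e'.exitParam := by
  refine hΩ.injOn_Ioo s he.exit_mem he'.exit_mem ?_
  rw [he.exit_eq, he'.exit_eq, (he.chord_le hΩ he').antisymm (he'.chord_le hΩ he)]

lemma turn_le (hΩ : IsStrictlyConvexTable Ω Γ L) (he : IsLeg Ω Γ L μ s θ e)
    (he' : IsLeg Ω Γ L μ s θ e') : e.turn ≤ e'.turn := by
  by_contra h
  have := he.arc_outside e'.turn ⟨he'.turn_pos, not_le.1 h⟩
  rw [he.exitParam_eq hΩ he', ← he'.reentry_eq] at this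
  exact this (hΩ.mem_closure _)

/-- The motion is deterministic. -/
lemma unique (hΩ : IsStrictlyConvexTable Ω Γ L) (he : IsLeg Ω Γ L μ s θ e)
    (he' : IsLeg Ω Γ L μ s θ e') : e = e' := by
  have h1 := he.exitParam_eq hΩ he'
  have h2 := (he.chord_le hΩ he').antisymm (he'.chord_le hΩ he)
  have h3 := (he.turn_le hΩ he').antisymm (he'.turn_le hΩ he)
  have h4 : e.reentryParam = e'.reentryParam := by
    refine hΩ.injOn_Ioo e.exitParam he.reentry_mem (h1 ▸ he'.reentry_mem) ?_
    rw [he.reentry_eq, he'.reentry_eq, h1, h3]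
  have h5 := he.exitAngle_eq
  have h6 := he.reentryAngle_eq
  rw [h1, ← he'.exitAngle_eq] at h5
  rw [h4, h3, ← he'.reentryAngle_eq] at h6
  cases e
  cases e'
  simp_all

end IsLeg

lemma leg_eq {Ω : Set ℂ} {Γ : ℝ → ℂ} {L μ : ℝ} {z : ℝ × ℝ} {e : Leg}
    (hΩ : IsStrictlyConvexTable Ω Γ L) (he : IsLeg Ω Γ L μ z.1 (phaseAngle z) e) :
    leg Ω Γ L μ z = e := by
  have h : ∃ e, IsLeg Ω Γ L μ z.1 (phaseAngle z) e := ⟨e, he⟩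
  rw [leg, dif_pos h]
  exact h.choose_spec.unique hΩ he

lemma billiardMap_eq {Ω : Set ℂ} {Γ : ℝ → ℂ} {L μ : ℝ} {z : ℝ × ℝ} {e : Leg}
    (hΩ : IsStrictlyConvexTable Ω Γ L) (he : IsLeg Ω Γ L μ z.1 (phaseAngle z) e) :
    billiardMap Ω Γ L μ z = (e.reentryParam, -Real.cos e.reentryAngle) := by
  rw [billiardMap, if_pos ⟨e, he⟩, leg_eq hΩ he]

/-! ### Smooth dependence of the motion on the initial condition -/

/-- The implicit function theorem for two real equations, written as one complex equation, in two
real unknowns. -/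
lemma exists_implicit {F : (ℝ × ℝ) × (ℝ × ℝ) → ℂ} {z q : ℝ × ℝ} (hF : ContDiffAt ℝ 1 F (z, q))
    {a b : ℂ} (ha : HasDerivAt (fun t => F (z, (t, q.2))) a q.1)
    (hb : HasDerivAt (fun t => F (z, (q.1, t))) b q.2) (hab : (conj a * b).im ≠ 0) :
    ∃ g : ℝ × ℝ → ℝ × ℝ, g z = q ∧ ContDiffAt ℝ 1 g z ∧
      ∀ᶠ w in 𝓝 z, F (w, g w) = F (z, q) := by
  have hd : HasFDerivAt F (fderiv ℝ F (z, q)) (z, q) :=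
    (hF.differentiableAt (by norm_num)).hasFDerivAt
  set D := fderiv ℝ F (z, q) ∘L .inr ℝ (ℝ × ℝ) (ℝ × ℝ) with hD
  have hDa : D (1, 0) = a := by
    have h1 : HasDerivAt (fun t : ℝ => (z, (t, q.2))) (0, (1, 0)) q.1 :=
      (hasDerivAt_const _ _).prodMk ((hasDerivAt_id _).prodMk (hasDerivAt_const _ _))
    exact (HasFDerivAt.comp_hasDerivAt q.1 hd h1).unique ha
  have hDb : D (0, 1) = b := by
    have h1 : HasDerivAt (fun t : ℝ => (z, (q.1, t))) (0, (0, 1)) q.2 :=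
      (hasDerivAt_const _ _).prodMk ((hasDerivAt_const _ _).prodMk (hasDerivAt_id _))
    exact (HasFDerivAt.comp_hasDerivAt q.2 hd h1).unique hb
  have hDxy : ∀ p : ℝ × ℝ, D p = p.1 * a + p.2 * b := by
    rintro ⟨x, y⟩
    have : ((x, y) : ℝ × ℝ) = x • (1, 0) + y • (0, 1) := by simp
    rw [this, map_add, map_smul, map_smul, hDa, hDb]
    simp
  have hinj : Function.Injective D := by
    rw [injective_iff_map_eq_zero]
    rintro ⟨x, y⟩ hxy
    rw [hDxy] at hxy
    have h0 := Complex.ext_iff.1 hxy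
    simp at h0 hab
    have hx : x * (a.re * b.im - a.im * b.re) = 0 := by
      linear_combination b.im * h0.1 - b.re * h0.2
    have hy : y * (a.re * b.im - a.im * b.re) = 0 := by
      linear_combination a.re * h0.2 - a.im * h0.1
    have hne : a.re * b.im - a.im * b.re ≠ 0 := fun h => hab (by linarith)
    simp [(mul_eq_zero.1 hx).resolve_right hne, (mul_eq_zero.1 hy).resolve_right hne]
  have hinv : D.IsInvertible :=
    ⟨(LinearEquiv.ofInjectiveOfFinrankEq (D : ℝ × ℝ →ₗ[ℝ] ℂ) hinj
      (by simp)).toContinuousLinearEquiv, by ext <;> rfl⟩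
  exact ⟨hF.implicitFunction (by norm_num) hinv, hF.implicitFunction_apply_self _ hinv,
    hF.contDiffAt_implicitFunction _ hinv, hF.eventually_apply_implicitFunction _ hinv⟩

variable {Ω : Set ℂ} {Γ : ℝ → ℂ} {L μ : ℝ}

lemma contDiffAt_phaseAngle {z : ℝ × ℝ} (hz : z.2 ∈ Ioo (-1 : ℝ) 1) :
    ContDiffAt ℝ 1 phaseAngle z :=
  (Real.contDiffAt_arccos (by linarith [hz.2]) (by linarith [hz.1])).comp z
    contDiff_snd.neg.contDiffAt

lemma contDiff_exp_ofReal_mul_I : ContDiff ℝ 1 fun x : ℝ => Complex.exp (x * Complex.I) :=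
  (Complex.ofRealCLM.contDiff.mul contDiff_const).cexp

lemma contDiffAt_velocity (hΩ : IsStrictlyConvexTable Ω Γ L) {z : ℝ × ℝ}
    (hz : z.2 ∈ Ioo (-1 : ℝ) 1) :
    ContDiffAt ℝ 1 (fun w : ℝ × ℝ => velocity Γ w.1 (phaseAngle w)) z :=
  (hΩ.contDiff_deriv.comp contDiff_fst).contDiffAt.mul
    (contDiff_exp_ofReal_mul_I.contDiffAt.comp z (contDiffAt_phaseAngle hz))

/-- A leg that ends transversally continues to a `C¹` family of solutions of the equations for the
exit point and for the re-entry point. -/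
lemma exists_local_solution (hΩ : IsStrictlyConvexTable Ω Γ L) (hμ : 0 < μ) {z : ℝ × ℝ} {e : Leg}
    (he : IsLeg Ω Γ L μ z.1 (phaseAngle z) e) (hre : e.reentryAngle ∈ Ioo 0 Real.pi) :
    ∃ S₁ ℓ S₂ φ : ℝ × ℝ → ℝ,
      (S₁ z = e.exitParam ∧ ℓ z = e.chord ∧ S₂ z = e.reentryParam ∧ φ z = e.turn) ∧
      (ContDiffAt ℝ 1 S₁ z ∧ ContDiffAt ℝ 1 ℓ z ∧ ContDiffAt ℝ 1 S₂ z ∧ ContDiffAt ℝ 1 φ z) ∧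
      (∀ᶠ w in 𝓝 z, Γ (S₁ w) = Γ w.1 + ℓ w * velocity Γ w.1 (phaseAngle w)) ∧
      ∀ᶠ w in 𝓝 z, Γ (S₂ w) =
        larmorArc μ (Γ (S₁ w)) (velocity Γ w.1 (phaseAngle w)) (φ w) := by
  have hz := phaseAngle_mem_Ioo_iff.1 he.angle_mem
  have hΓ : ContDiff ℝ 1 Γ := hΩ.contDiff.of_le (by norm_num)
  have hV := contDiffAt_velocity hΩ hz
  have hΓd : ∀ s, HasDerivAt Γ (deriv Γ s) s := fun s => (hΩ.differentiable s).hasDerivAt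
  obtain ⟨g, hg0, hg1, hg2⟩ := exists_implicit
    (F := fun p => Γ p.1.1 + p.2.2 * velocity Γ p.1.1 (phaseAngle p.1) - Γ p.2.1)
    (z := z) (q := (e.exitParam, e.chord)) (a := -deriv Γ e.exitParam)
    (b := velocity Γ z.1 (phaseAngle z))
    (by
      have h1 : ContDiffAt ℝ 1 (fun p : (ℝ × ℝ) × (ℝ × ℝ) =>
          velocity Γ p.1.1 (phaseAngle p.1)) (z, (e.exitParam, e.chord)) :=
        ContDiffAt.comp (z, (e.exitParam, e.chord)) hV contDiffAt_fst
      have h2 : ContDiff ℝ 1 (fun p : (ℝ × ℝ) × (ℝ × ℝ) => ((p.2.2 : ℝ) : ℂ)) :=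
        Complex.ofRealCLM.contDiff.comp contDiff_snd.snd
      have h3 : ContDiff ℝ 1 (fun p : (ℝ × ℝ) × (ℝ × ℝ) => Γ p.1.1) :=
        hΓ.comp contDiff_fst.fst
      have h4 : ContDiff ℝ 1 (fun p : (ℝ × ℝ) × (ℝ × ℝ) => Γ p.2.1) :=
        hΓ.comp contDiff_snd.fst
      exact (h3.contDiffAt.add (h2.contDiffAt.mul h1)).sub h4.contDiffAt)
    (HasDerivAt.const_sub (Γ z.1 + e.chord * velocity Γ z.1 (phaseAngle z)) (hΓd e.exitParam))
    (by simpa using (((hasDerivAt_id e.chord).ofReal_comp.mul_const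
      (velocity Γ z.1 (phaseAngle z))).const_add (Γ z.1)).sub_const (Γ e.exitParam))
    (by
      rw [map_neg, neg_mul, Complex.neg_im]
      exact neg_ne_zero.2 (he.exit_im_neg hΩ).ne)
  have hS₁ : ContDiffAt ℝ 1 (fun w => (g w).1) z := hg1.fst
  obtain ⟨k, hk0, hk1, hk2⟩ := exists_implicit
    (F := fun p => larmorArc μ (Γ (g p.1).1) (velocity Γ p.1.1 (phaseAngle p.1)) p.2.2 - Γ p.2.1)
    (z := z) (q := (e.reentryParam, e.turn)) (a := -deriv Γ e.reentryParam)
    (b := μ * (Complex.exp (e.turn * Complex.I) * velocity Γ z.1 (phaseAngle z)))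
    (by
      have h1 : ContDiffAt ℝ 1 (fun p : (ℝ × ℝ) × (ℝ × ℝ) =>
          velocity Γ p.1.1 (phaseAngle p.1)) (z, (e.reentryParam, e.turn)) :=
        ContDiffAt.comp (z, (e.reentryParam, e.turn)) hV contDiffAt_fst
      have h2 : ContDiff ℝ 1 (fun p : (ℝ × ℝ) × (ℝ × ℝ) =>
          Complex.exp (p.2.2 * Complex.I)) :=
        contDiff_exp_ofReal_mul_I.comp contDiff_snd.snd
      have h3 : ContDiffAt ℝ 1 (fun p : (ℝ × ℝ) × (ℝ × ℝ) => Γ (g p.1).1)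
          (z, (e.reentryParam, e.turn)) :=
        ContDiffAt.comp (g := fun w => Γ (g w).1) (z, (e.reentryParam, e.turn))
          (hΓ.contDiffAt.comp z hS₁) contDiffAt_fst
      have h4 : ContDiff ℝ 1 (fun p : (ℝ × ℝ) × (ℝ × ℝ) => Γ p.2.1) :=
        hΓ.comp contDiff_snd.fst
      simp only [larmorArc_eq]
      exact (h3.add (contDiffAt_const.mul (h1.sub (h2.contDiffAt.mul h1)))).sub h4.contDiffAt)
    (HasDerivAt.const_sub
      (larmorArc μ (Γ (g z).1) (velocity Γ z.1 (phaseAngle z)) e.turn) (hΓd e.reentryParam))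
    ((hasDerivAt_larmorArc μ (Γ (g z).1) (velocity Γ z.1 (phaseAngle z)) e.turn).sub_const
      (Γ e.reentryParam))
    (by
      have := (he.reentry_im_pos hΩ hμ hre).ne'
      rw [map_neg, neg_mul, Complex.neg_im, mul_left_comm, Complex.im_ofReal_mul]
      exact neg_ne_zero.2 (mul_ne_zero hμ.ne' this))
  refine ⟨fun w => (g w).1, fun w => (g w).2, fun w => (k w).1, fun w => (k w).2,
    by simp [hg0, hk0], ⟨hS₁, hg1.snd, hk1.fst, hk1.snd⟩, ?_, ?_⟩
  · filter_upwards [hg2] with w hw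
    have h0 := he.exit_eq
    rw [← h0, sub_self] at hw
    exact (sub_eq_zero.1 hw).symm
  · filter_upwards [hk2] with w hw
    simp only [hg0] at hw
    rw [← he.reentry_eq, sub_self] at hw
    exact (sub_eq_zero.1 hw).symm

lemma continuousAt_angle_comp {X : Type*} [TopologicalSpace X] {f g : X → ℂ} {x : X}
    (hf : ContinuousAt f x) (hg : ContinuousAt g x) (hf0 : f x ≠ 0) (hg0 : g x ≠ 0) :
    ContinuousAt (fun y => InnerProductGeometry.angle (f y) (g y)) x :=
  ContinuousAt.comp (f := fun y => (f y, g y)) (g := fun p => InnerProductGeometry.angle p.1 p.2)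
    (InnerProductGeometry.continuousAt_angle (x := (f x, g x)) hf0 hg0) (hf.prodMk hg)

/-- Near a leg that ends transversally, the motion is given by the `C¹` solutions of the equations
for the exit point and the re-entry point. The beginning and the end of the arc stay outside the
table by transversality, the middle part by compactness. -/
lemma eventually_isLeg (hΩ : IsStrictlyConvexTable Ω Γ L) (hμ : 0 < μ) {z : ℝ × ℝ} {e : Leg}
    (he : IsLeg Ω Γ L μ z.1 (phaseAngle z) e) (hre : e.reentryAngle ∈ Ioo 0 Real.pi)
    {S₁ ℓ S₂ φ : ℝ × ℝ → ℝ}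
    (h0 : S₁ z = e.exitParam ∧ ℓ z = e.chord ∧ S₂ z = e.reentryParam ∧ φ z = e.turn)
    (hc : ContinuousAt S₁ z ∧ ContinuousAt ℓ z ∧ ContinuousAt S₂ z ∧ ContinuousAt φ z)
    (h1 : ∀ᶠ w in 𝓝 z, Γ (S₁ w) = Γ w.1 + ℓ w * velocity Γ w.1 (phaseAngle w))
    (h2 : ∀ᶠ w in 𝓝 z, Γ (S₂ w) =
        larmorArc μ (Γ (S₁ w)) (velocity Γ w.1 (phaseAngle w)) (φ w)) :
    ∀ᶠ w in 𝓝 z, IsLeg Ω Γ L μ w.1 (phaseAngle w)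
      ⟨S₁ w, ℓ w,
        InnerProductGeometry.angle (deriv Γ (S₁ w)) (velocity Γ w.1 (phaseAngle w)),
        φ w, S₂ w,
        InnerProductGeometry.angle (deriv Γ (S₂ w))
          (Complex.exp (φ w * Complex.I) * velocity Γ w.1 (phaseAngle w))⟩ := by
  obtain ⟨h0₁, h0ℓ, h0₂, h0φ⟩ := h0
  obtain ⟨hc₁, hcℓ, hc₂, hcφ⟩ := hc
  have hz := phaseAngle_mem_Ioo_iff.1 he.angle_mem
  have hV := (contDiffAt_velocity hΩ hz).continuousAt
  have hΓc : Continuous Γ := hΩ.differentiable.continuous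
  have hΓ'c : Continuous (deriv Γ) := hΩ.contDiff_deriv.continuous
  have hne : ∀ s, deriv Γ s ≠ 0 := fun s h => by simpa [h] using hΩ.unit_speed s
  have hV0 : ∀ w : ℝ × ℝ, velocity Γ w.1 (phaseAngle w) ≠ 0 := fun w h => by
    simpa [h] using norm_velocity hΩ w.1 (phaseAngle w)
  have hexp : ContinuousAt (fun w : ℝ × ℝ => Complex.exp (φ w * Complex.I)) z := by
    have : Continuous fun x : ℝ => Complex.exp (x * Complex.I) := by fun_prop
    exact this.continuousAt.comp hcφ
  have hW := hexp.mul hV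
  have hΓ₁ : ContinuousAt (fun w => deriv Γ (S₁ w)) z := hΓ'c.continuousAt.comp hc₁
  have hΓ₂ : ContinuousAt (fun w => deriv Γ (S₂ w)) z := hΓ'c.continuousAt.comp hc₂
  have e1 : ∀ᶠ w : ℝ × ℝ in 𝓝 z, w.2 ∈ Ioo (-1 : ℝ) 1 :=
    continuous_snd.continuousAt.eventually (isOpen_Ioo.mem_nhds hz)
  have e2 : ∀ᶠ w in 𝓝 z, 0 < ℓ w :=
    hcℓ.eventually (lt_mem_nhds (h0ℓ ▸ he.chord_pos))
  have e3 : ∀ᶠ w in 𝓝 z, 0 < φ w :=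
    hcφ.eventually (lt_mem_nhds (h0φ ▸ he.turn_pos))
  have e4 : ∀ᶠ w in 𝓝 z, w.1 < S₁ w :=
    continuous_fst.continuousAt.eventually_lt hc₁ (h0₁ ▸ he.exit_mem.1)
  have e5 : ∀ᶠ w in 𝓝 z, S₁ w < w.1 + L :=
    hc₁.eventually_lt (continuous_fst.add continuous_const).continuousAt (h0₁ ▸ he.exit_mem.2)
  have e6 : ∀ᶠ w in 𝓝 z, S₁ w < S₂ w :=
    hc₁.eventually_lt hc₂ (by rw [h0₁, h0₂]; exact he.reentry_mem.1)
  have e7 : ∀ᶠ w in 𝓝 z, S₂ w < S₁ w + L :=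
    hc₂.eventually_lt (hc₁.add continuousAt_const) (by rw [h0₁, h0₂]; exact he.reentry_mem.2)
  have c8 : ContinuousAt (fun w : ℝ × ℝ =>
      (conj (deriv Γ (S₁ w)) * velocity Γ w.1 (phaseAngle w)).im) z :=
    Complex.continuous_im.continuousAt.comp
      ((Complex.continuous_conj.continuousAt.comp hΓ₁).mul hV)
  have e8 : ∀ᶠ w : ℝ × ℝ in 𝓝 z,
      (conj (deriv Γ (S₁ w)) * velocity Γ w.1 (phaseAngle w)).im < 0 :=
    c8.eventually_lt continuousAt_const (by rw [h0₁]; exact he.exit_im_neg hΩ)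
  have c9 : ContinuousAt (fun w : ℝ × ℝ => (conj (deriv Γ (S₂ w)) *
      (Complex.exp (φ w * Complex.I) * velocity Γ w.1 (phaseAngle w))).im) z :=
    Complex.continuous_im.continuousAt.comp
      ((Complex.continuous_conj.continuousAt.comp hΓ₂).mul hW)
  have e9 : ∀ᶠ w : ℝ × ℝ in 𝓝 z, 0 < (conj (deriv Γ (S₂ w)) *
      (Complex.exp (φ w * Complex.I) * velocity Γ w.1 (phaseAngle w))).im :=
    continuousAt_const.eventually_lt c9
      (by rw [h0₂, h0φ]; exact he.reentry_im_pos hΩ hμ hre)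
  have hχ₁ : ContinuousAt (fun w : ℝ × ℝ => InnerProductGeometry.angle (deriv Γ (S₁ w))
      (velocity Γ w.1 (phaseAngle w))) z := continuousAt_angle_comp hΓ₁ hV (hne _) (hV0 z)
  have hχ₂ : ContinuousAt (fun w : ℝ × ℝ => InnerProductGeometry.angle (deriv Γ (S₂ w))
      (Complex.exp (φ w * Complex.I) * velocity Γ w.1 (phaseAngle w))) z :=
    continuousAt_angle_comp hΓ₂ hW (hne _) (mul_ne_zero (Complex.exp_ne_zero _) (hV0 z))
  have hθ₁ : 0 < e.exitAngle := by
    rw [he.exitAngle_eq]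
    exact ((angle_mem_Ioo_iff (hΩ.unit_speed _) (norm_velocity hΩ _ _)).2
      (he.exit_im_neg hΩ).ne).1
  -- turning through `exitAngle` from the exit, half of what the tangent line allows at `z`, keeps
  -- the arc outside near `z`; likewise for the last `reentryAngle` before the re-entry
  have e10 : ∀ᶠ w : ℝ × ℝ in 𝓝 z, e.exitAngle < 2 * InnerProductGeometry.angle
      (deriv Γ (S₁ w)) (velocity Γ w.1 (phaseAngle w)) :=
    continuousAt_const.eventually_lt (continuousAt_const.mul hχ₁)
      (by rw [h0₁, ← he.exitAngle_eq]; linarith)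
  have e11 : ∀ᶠ w : ℝ × ℝ in 𝓝 z, φ w - 2 * InnerProductGeometry.angle (deriv Γ (S₂ w))
      (Complex.exp (φ w * Complex.I) * velocity Γ w.1 (phaseAngle w)) <
        e.turn - e.reentryAngle :=
    (hcφ.sub (continuousAt_const.mul hχ₂)).eventually_lt continuousAt_const
      (by simp only [Pi.sub_apply, Pi.mul_apply]; rw [h0₂, h0φ, ← he.reentryAngle_eq]; linarith [hre.1])
  -- the remaining compact part of the arc
  have e12 : ∀ᶠ w in 𝓝 z, ∀ ψ ∈ Icc e.exitAngle (e.turn - e.reentryAngle),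
      larmorArc μ (Γ (S₁ w)) (velocity Γ w.1 (phaseAngle w)) ψ ∉ closure Ω := by
    refine isCompact_Icc.eventually_forall_of_forall_eventually (x₀ := z) (P := fun (w : ℝ × ℝ) ψ =>
      larmorArc μ (Γ (S₁ w)) (velocity Γ w.1 (phaseAngle w)) ψ ∉ closure Ω) fun ψ hψ => ?_
    have hcont : ContinuousAt (fun p : (ℝ × ℝ) × ℝ =>
        larmorArc μ (Γ (S₁ p.1)) (velocity Γ p.1.1 (phaseAngle p.1)) p.2) (z, ψ) := by
      have c1 : ContinuousAt (fun p : (ℝ × ℝ) × ℝ => Γ (S₁ p.1)) (z, ψ) :=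
        ContinuousAt.comp (x := (z, ψ)) (f := Prod.fst) (g := fun w => Γ (S₁ w))
          (hΓc.continuousAt.comp hc₁) continuousAt_fst
      have c2 : ContinuousAt (fun p : (ℝ × ℝ) × ℝ => velocity Γ p.1.1 (phaseAngle p.1)) (z, ψ) :=
        ContinuousAt.comp (x := (z, ψ)) (f := Prod.fst)
          (g := fun w : ℝ × ℝ => velocity Γ w.1 (phaseAngle w)) hV continuousAt_fst
      have c3 : Continuous (fun p : (ℝ × ℝ) × ℝ => Complex.exp (p.2 * Complex.I)) := by fun_prop
      simp only [larmorArc_eq]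
      exact c1.add (continuousAt_const.mul (c2.sub (c3.continuousAt.mul c2)))
    have hout : larmorArc μ (Γ (S₁ z)) (velocity Γ z.1 (phaseAngle z)) ψ ∈ (closure Ω)ᶜ := by
      rw [h0₁]
      exact he.arc_outside ψ ⟨by linarith [hψ.1], by linarith [hψ.2, hre.1]⟩
    exact hcont.eventually_mem (isClosed_closure.isOpen_compl.mem_nhds hout)
  filter_upwards [h1, h2, e1, e2, e3, e4, e5, e6, e7, e8, e9, e10, e11, e12] with
    w h1 h2 e1 e2 e3 e4 e5 e6 e7 e8 e9 e10 e11 e12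
  have hin : ∀ t ∈ Ioo 0 (ℓ w), Γ w.1 + t * velocity Γ w.1 (phaseAngle w) ∈ Ω := by
    intro t ht
    suffices h : Γ w.1 + t * velocity Γ w.1 (phaseAngle w) ∈ openSegment ℝ (Γ w.1) (Γ (S₁ w)) from
      hΩ.openSegment_subset (hΩ.mem_closure w.1) (hΩ.mem_closure (S₁ w))
        (hΩ.ne_of_mem_Ioo ⟨e4, e5⟩) h
    refine ⟨1 - t / ℓ w, t / ℓ w, ?_, div_pos ht.1 e2, by ring, ?_⟩
    · rw [sub_pos, div_lt_one e2]
      exact ht.2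
    · rw [h1]
      have : (ℓ w : ℂ) ≠ 0 := by exact_mod_cast e2.ne'
      simp only [Complex.real_smul]
      push_cast
      field_simp
      ring
  have hout : ∀ ψ ∈ Ioo 0 (φ w),
      larmorArc μ (Γ (S₁ w)) (velocity Γ w.1 (phaseAngle w)) ψ ∉ closure Ω := by
    intro ψ hψ
    rcases lt_or_ge ψ e.exitAngle with hlt | hge
    · exact hΩ.larmorArc_notMem_of_exit hμ (norm_velocity hΩ _ _) e8 hψ.1 (hlt.trans e10)
    rcases le_or_gt ψ (e.turn - e.reentryAngle) with hle | hgt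
    · exact e12 ψ ⟨hge, hle⟩
    · exact hΩ.larmorArc_notMem_of_reentry hμ (norm_velocity hΩ _ _) h2 e9 hψ.2 (e11.trans hgt)
  exact
    { angle_mem := phaseAngle_mem_Ioo_iff.2 e1
      chord_pos := e2
      chord_inside := hin
      exit_mem := ⟨e4, e5⟩
      exit_eq := h1
      exitAngle_eq := rfl
      turn_pos := e3
      arc_outside := hout
      reentry_mem := ⟨e6, e7⟩
      reentry_eq := h2
      reentryAngle_eq := rfl }

/-! ### The derivative of the billiard map -/

/-- The signed curvature of the unit-speed curve `Γ` at the parameter `s`. -/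
def curvature (Γ : ℝ → ℂ) (s : ℝ) : ℝ :=
  (conj (deriv Γ s) * deriv (deriv Γ) s).im

lemma IsStrictlyConvexTable.hasDerivAt_deriv (hΩ : IsStrictlyConvexTable Ω Γ L) (s : ℝ) :
    HasDerivAt (deriv Γ) (Complex.I * curvature Γ s * deriv Γ s) s := by
  have h := (hΩ.contDiff_deriv.differentiable (by norm_num) s).hasDerivAt
  have h1 : HasDerivAt (fun t => conj (deriv Γ t)) (conj (deriv (deriv Γ) s)) s :=
    (Complex.conjCLE.hasFDerivAt (x := deriv Γ s)).comp_hasDerivAt s h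
  have h2 : (fun t => conj (deriv Γ t) * deriv Γ t) = fun _ => (1 : ℂ) := by
    funext t
    rw [mul_comm, Complex.mul_conj, Complex.normSq_eq_norm_sq, hΩ.unit_speed]
    simp
  have h3 := h1.mul h
  change HasDerivAt (fun t => conj (deriv Γ t) * deriv Γ t) _ s at h3
  rw [h2] at h3
  have h4 := congrArg Complex.re (h3.unique (hasDerivAt_const s (1 : ℂ)))
  have h5 : (conj (deriv Γ s) * deriv (deriv Γ) s).re = 0 := by
    simp at h4 ⊢
    linarith
  have h6 : conj (deriv Γ s) * deriv (deriv Γ) s = Complex.I * curvature Γ s := by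
    apply Complex.ext
    · simp [h5]
    · simp [curvature]
  refine h.congr_deriv ?_
  rw [← h6, mul_comm, mul_conj_mul_of_norm_eq_one (hΩ.unit_speed s)]

/-- The rotation rate of the initial velocity when the phase point `z = (s, u)` moves in the
direction `h`. -/
def rotationRate (Γ : ℝ → ℂ) (z h : ℝ × ℝ) : ℝ :=
  curvature Γ z.1 * h.1 + h.2 / Real.sin (phaseAngle z)

lemma hasDerivAt_line (z h : ℝ × ℝ) : HasDerivAt (fun t : ℝ => z + t • h) h 0 := by
  simpa using ((hasDerivAt_id (0 : ℝ)).smul_const h).const_add z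

lemma hasDerivAt_velocity_line (hΩ : IsStrictlyConvexTable Ω Γ L) {z : ℝ × ℝ}
    (hz : z.2 ∈ Ioo (-1 : ℝ) 1) (h : ℝ × ℝ) :
    HasDerivAt (fun t : ℝ => velocity Γ (z + t • h).1 (phaseAngle (z + t • h)))
      (Complex.I * rotationRate Γ z h * velocity Γ z.1 (phaseAngle z)) 0 := by
  have hl := hasDerivAt_line z h
  have h1 : HasDerivAt (fun t : ℝ => (z + t • h).1) h.1 0 :=
    (ContinuousLinearMap.fst ℝ ℝ ℝ).hasFDerivAt.comp_hasDerivAt 0 hl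
  have h2 : HasDerivAt (fun t : ℝ => (z + t • h).2) h.2 0 :=
    (ContinuousLinearMap.snd ℝ ℝ ℝ).hasFDerivAt.comp_hasDerivAt 0 hl
  have h3 : HasDerivAt (fun t : ℝ => phaseAngle (z + t • h)) (h.2 / Real.sin (phaseAngle z)) 0 := by
    have h4 : HasDerivAt Real.arccos (-(1 / √(1 - (-(z + (0 : ℝ) • h).2) ^ 2)))
        (-(z + (0 : ℝ) • h).2) :=
      Real.hasDerivAt_arccos (by simp; linarith [hz.2]) (by simp; linarith [hz.1])
    refine (h4.comp 0 h2.neg).congr_deriv ?_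
    rw [phaseAngle, Real.sin_arccos, zero_smul, add_zero]
    ring
  have h5 : HasDerivAt (deriv Γ) (Complex.I * curvature Γ z.1 * deriv Γ z.1)
      (z + (0 : ℝ) • h).1 := by
    simpa using hΩ.hasDerivAt_deriv z.1
  have h6 := (h5.scomp 0 h1).mul (h3.ofReal_comp.mul_const Complex.I).cexp
  refine h6.congr_deriv ?_
  simp only [velocity, rotationRate, Function.comp, zero_smul, add_zero, Complex.real_smul]
  push_cast
  ring

/-- Transversal coordinates of a variation of the initial condition `Γ s`, `velocity Γ s θ`: the
matrix takes `(ds, du)` to the displacement of the base point perpendicular to the velocity and to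
the rotation rate of the velocity. -/
def transversalFrame (Γ : ℝ → ℂ) (s θ : ℝ) : Matrix (Fin 2) (Fin 2) ℝ :=
  !![-Real.sin θ, 0; curvature Γ s, 1 / Real.sin θ]

/-- In transversal coordinates, the derivative of a chord of length `ℓ` followed by a half circle
of radius `μ`, where `c` is `1 / μ` times the sum of the cotangents of the exit and the re-entry
angle. -/
def halfTurnMatrix (ℓ c : ℝ) : Matrix (Fin 2) (Fin 2) ℝ :=
  !![-1, -ℓ; c, c * ℓ - 1]

lemma billiardMap_eventuallyEq (hΩ : IsStrictlyConvexTable Ω Γ L) {z : ℝ × ℝ}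
    {S₁ ℓ S₂ φ : ℝ × ℝ → ℝ}
    (h : ∀ᶠ w in 𝓝 z, IsLeg Ω Γ L μ w.1 (phaseAngle w)
      ⟨S₁ w, ℓ w,
        InnerProductGeometry.angle (deriv Γ (S₁ w)) (velocity Γ w.1 (phaseAngle w)),
        φ w, S₂ w,
        InnerProductGeometry.angle (deriv Γ (S₂ w))
          (Complex.exp (φ w * Complex.I) * velocity Γ w.1 (phaseAngle w))⟩) :
    billiardMap Ω Γ L μ =ᶠ[𝓝 z] fun w => (S₂ w, -(conj (deriv Γ (S₂ w)) *
      (Complex.exp (φ w * Complex.I) * velocity Γ w.1 (phaseAngle w))).re) := by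
  filter_upwards [h] with w hw
  rw [billiardMap_eq hΩ hw]
  simp only
  rw [cos_angle_of_norm_eq_one (hΩ.unit_speed _) (IsLeg.norm_reentryVelocity hΩ _)]

/-- The linearised motion across a leg whose arc is a half circle. Here `v` is the velocity along
the chord, `g₀`, `g₁`, `g₂` are the unit tangents at the start, exit and re-entry points, `E` is the
rotation along the arc, `a` and `η` are the rates of the start parameter and of the rotation of `v`,
and the letters with `δ` are the rates of the other data of the leg. The hypotheses `hchord` and
`harc` are the derivatives of the equations for the exit point and the re-entry point. -/
lemma linearised_leg {a η δs₁ δℓ δφ δs₂ ℓ μ θ₀ θ₁ θ₂ : ℝ} {v g₀ g₁ g₂ E : ℂ} (hμ : 0 < μ)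
    (hv : ‖v‖ = 1) (hE : E = -1) (h₀ : v = g₀ * Complex.exp (θ₀ * Complex.I))
    (h₁ : v = g₁ * Complex.exp (-θ₁ * Complex.I))
    (h₂ : E * v = g₂ * Complex.exp (θ₂ * Complex.I))
    (hs₁ : Real.sin θ₁ ≠ 0) (hs₂ : Real.sin θ₂ ≠ 0)
    (hchord : δs₁ • g₁ = a • g₀ + (δℓ * v + ℓ * (Complex.I * η * v)))
    (harc : δs₂ • g₂ = δs₁ • g₁ + μ * Complex.I *
      (Complex.I * η * v - (E * (δφ * Complex.I) * v + E * (Complex.I * η * v)))) :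
    Real.sin θ₂ * δs₂ = -Real.sin θ₀ * a + ℓ * η ∧
    η + δφ = (Real.cot θ₁ + Real.cot θ₂) / μ * (-Real.sin θ₀ * a + ℓ * η) - η := by
  have hv0 : v ≠ 0 := fun h => by simp [h] at hv
  have hexp : ∀ x : ℝ, Complex.exp (x * Complex.I) * Complex.exp (-x * Complex.I) = 1 := fun x => by
    rw [← Complex.exp_add]; simp
  have e₀ : g₀ = v * Complex.exp (-θ₀ * Complex.I) := by
    rw [h₀, mul_assoc, hexp, mul_one]
  have e₁ : g₁ = v * Complex.exp (θ₁ * Complex.I) := by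
    rw [h₁, mul_assoc, mul_comm (Complex.exp _), hexp, mul_one]
  have e₂ : g₂ = -v * Complex.exp (-θ₂ * Complex.I) := by
    rw [hE] at h₂
    rw [← neg_one_mul, h₂, mul_assoc, hexp, mul_one]
  have c1 : (δs₁ : ℂ) * Complex.exp (θ₁ * Complex.I) =
      a * Complex.exp ((-θ₀ : ℝ) * Complex.I) + (δℓ + ℓ * η * Complex.I) := by
    apply mul_left_cancel₀ hv0
    rw [e₀, e₁, Complex.real_smul, Complex.real_smul] at hchord
    push_cast
    linear_combination hchord
  have c2 : (δs₂ : ℂ) * -Complex.exp ((-θ₂ : ℝ) * Complex.I) =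
      δs₁ * Complex.exp (θ₁ * Complex.I) - μ * (2 * η + δφ) := by
    apply mul_left_cancel₀ hv0
    rw [e₁, e₂, hE, Complex.real_smul, Complex.real_smul] at harc
    push_cast
    linear_combination harc + μ * v * (2 * η + δφ) * Complex.I_sq
  have i1 := congrArg Complex.im c1
  have i2 := congrArg Complex.im c2
  have r2 := congrArg Complex.re c2
  simp only [Complex.exp_ofReal_mul_I_im,
    Complex.exp_ofReal_mul_I_re, Complex.add_im, Complex.sub_im, Complex.sub_re, Complex.neg_im,
    Complex.neg_re, Complex.ofReal_im, Complex.ofReal_re, Complex.add_re, Complex.mul_im,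
    Complex.mul_re, Complex.I_re, Complex.I_im, Real.sin_neg, Real.cos_neg] at i1 i2 r2
  norm_num at i1 i2 r2
  have k2 : Real.sin θ₂ * δs₂ = -Real.sin θ₀ * a + ℓ * η := by linarith
  have k1 : Real.sin θ₁ * δs₁ = -Real.sin θ₀ * a + ℓ * η := by linarith
  refine ⟨k2, ?_⟩
  rw [Real.cot_eq_cos_div_sin, Real.cot_eq_cos_div_sin]
  have q1 : Real.cos θ₁ / Real.sin θ₁ * (-Real.sin θ₀ * a + ℓ * η) = Real.cos θ₁ * δs₁ := by
    rw [← k1]; field_simp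
  have q2 : Real.cos θ₂ / Real.sin θ₂ * (-Real.sin θ₀ * a + ℓ * η) = Real.cos θ₂ * δs₂ := by
    rw [← k2]; field_simp
  rw [div_mul_eq_mul_div, add_mul, q1, q2]
  field_simp
  linarith

/-- The rate of change of `u = -cos θ`, when the base point moves at the rate `δ` along a curve of
curvature `κ` and the velocity `w` rotates at the rate `r`. -/
lemma reentry_rate {κ δ r θ : ℝ} {g w : ℂ} (hg : ‖g‖ = 1)
    (hw : w = g * Complex.exp (θ * Complex.I)) :
    -(conj (δ • (Complex.I * κ * g)) * w + conj g * (Complex.I * r * w)).re =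
      Real.sin θ * (r - κ * δ) := by
  have h1 : conj g * g = 1 := by
    rw [mul_comm, Complex.mul_conj, Complex.normSq_eq_norm_sq, hg]; simp
  have h2 : conj (δ • (Complex.I * κ * g)) * w + conj g * (Complex.I * r * w) =
      ((r - κ * δ : ℝ) : ℂ) * (Complex.I * Complex.exp (θ * Complex.I)) := by
    rw [hw]
    simp only [Complex.real_smul, map_mul, Complex.conj_ofReal, Complex.conj_I]
    push_cast
    linear_combination (Complex.I * (r - κ * δ) * Complex.exp (θ * Complex.I)) * h1
  rw [h2, Complex.re_ofReal_mul, Complex.I_mul_re, Complex.exp_ofReal_mul_I_im]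
  ring

/-- Across a leg whose arc is a half circle, the billiard map is differentiable, and in transversal
coordinates its derivative does not depend on the curvature of the boundary. -/
theorem differentiableAt_and_transversalFrame_mul_jacobian (hΩ : IsStrictlyConvexTable Ω Γ L)
    (hμ : 0 < μ) {z : ℝ × ℝ} {e : Leg} (he : IsLeg Ω Γ L μ z.1 (phaseAngle z) e)
    (hre : e.reentryAngle ∈ Ioo 0 Real.pi) (hturn : Complex.exp (e.turn * Complex.I) = -1) :
    DifferentiableAt ℝ (billiardMap Ω Γ L μ) z ∧
    transversalFrame Γ e.reentryParam e.reentryAngle * jacobian Ω Γ L μ z =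
      halfTurnMatrix e.chord ((Real.cot e.exitAngle + Real.cot e.reentryAngle) / μ) *
        transversalFrame Γ z.1 (phaseAngle z) := by
  have hz := phaseAngle_mem_Ioo_iff.1 he.angle_mem
  obtain ⟨S₁, ℓ, S₂, φ, h0, ⟨d1, d2, d3, d4⟩, hchord, harc⟩ := exists_local_solution hΩ hμ he hre
  have hleg := eventually_isLeg hΩ hμ he hre h0
    ⟨d1.continuousAt, d2.continuousAt, d3.continuousAt, d4.continuousAt⟩ hchord harc
  have hB := billiardMap_eventuallyEq hΩ hleg
  obtain ⟨h0₁, h0ℓ, h0₂, h0φ⟩ := h0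
  have hV := contDiffAt_velocity hΩ hz
  have hdiff : DifferentiableAt ℝ (billiardMap Ω Γ L μ) z := by
    refine (DifferentiableAt.congr_of_eventuallyEq ?_ hB)
    have f1 : ContDiffAt ℝ 1 (fun w => conj (deriv Γ (S₂ w))) z :=
      Complex.conjCLE.contDiff.contDiffAt.comp z (hΩ.contDiff_deriv.contDiffAt.comp z d3)
    have f2 : ContDiffAt ℝ 1 (fun w => Complex.exp (φ w * Complex.I)) z :=
      contDiff_exp_ofReal_mul_I.contDiffAt.comp z d4
    have f3 : ContDiffAt ℝ 1 (fun w : ℝ × ℝ => -(conj (deriv Γ (S₂ w)) *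
        (Complex.exp (φ w * Complex.I) * velocity Γ w.1 (phaseAngle w))).re) z :=
      (Complex.reCLM.contDiff.contDiffAt.comp z (f1.mul (f2.mul hV))).neg
    exact (d3.prodMk f3).differentiableAt (by norm_num)
  refine ⟨hdiff, ?_⟩
  have h₁ := eq_mul_exp_neg_angle (hΩ.unit_speed e.exitParam) (norm_velocity hΩ z.1 (phaseAngle z))
    (he.exit_im_neg hΩ)
  have h₂ := eq_mul_exp_angle (hΩ.unit_speed e.reentryParam)
    (IsLeg.norm_reentryVelocity hΩ e.turn) (he.reentry_im_pos hΩ hμ hre)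
  have hs₁ : 0 < Real.sin e.exitAngle := by
    rw [he.exitAngle_eq]
    exact Real.sin_pos_of_mem_Ioo ((angle_mem_Ioo_iff (hΩ.unit_speed _)
      (norm_velocity hΩ _ _)).2 (he.exit_im_neg hΩ).ne)
  have hs₂ := Real.sin_pos_of_mem_Ioo hre
  rw [← he.exitAngle_eq] at h₁
  rw [← he.reentryAngle_eq] at h₂
  -- the derivative in the direction `h`, in transversal coordinates
  have key : ∀ h : ℝ × ℝ,
      Real.sin e.reentryAngle * (fderiv ℝ (billiardMap Ω Γ L μ) z h).1 =
        -Real.sin (phaseAngle z) * h.1 + e.chord * rotationRate Γ z h ∧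
      (fderiv ℝ (billiardMap Ω Γ L μ) z h).2 / Real.sin e.reentryAngle +
        curvature Γ e.reentryParam * (fderiv ℝ (billiardMap Ω Γ L μ) z h).1 =
        (Real.cot e.exitAngle + Real.cot e.reentryAngle) / μ *
          (-Real.sin (phaseAngle z) * h.1 + e.chord * rotationRate Γ z h) -
          rotationRate Γ z h := by
    intro h
    have hl := hasDerivAt_line z h
    have hz0 : z + (0 : ℝ) • h = z := by simp
    have htend : Tendsto (fun t : ℝ => z + t • h) (𝓝 0) (𝓝 z) := by
      simpa using hl.continuousAt.tendsto
    have lift : ∀ {f : ℝ × ℝ → ℝ}, ContDiffAt ℝ 1 f z →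
        HasDerivAt (fun t : ℝ => f (z + t • h)) (fderiv ℝ f z h) 0 := fun {f} hf => by
      have h1 : HasFDerivAt f (fderiv ℝ f z) (z + (0 : ℝ) • h) := by
        rw [hz0]; exact (hf.differentiableAt (by norm_num)).hasFDerivAt
      exact h1.comp_hasDerivAt 0 hl
    have liftΓ : ∀ {f : ℝ × ℝ → ℝ} {s : ℝ}, ContDiffAt ℝ 1 f z → f z = s →
        HasDerivAt (fun t : ℝ => Γ (f (z + t • h))) (fderiv ℝ f z h • deriv Γ s) 0 :=
      fun {f s} hf hs => by
        have h1 : HasDerivAt Γ (deriv Γ s) (f (z + (0 : ℝ) • h)) := by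
          rw [hz0, hs]; exact (hΩ.differentiable s).hasDerivAt
        exact h1.scomp 0 (lift hf)
    have hvel := hasDerivAt_velocity_line hΩ hz h
    have hΓ₀ : HasDerivAt (fun t : ℝ => Γ (z + t • h).1) (h.1 • deriv Γ z.1) 0 := by
      simpa [fderiv_fst] using liftΓ (f := Prod.fst) contDiffAt_fst rfl
    have hexp := ((lift d4).ofReal_comp.mul_const Complex.I).cexp
    have hvel₂ := hexp.mul hvel
    rw [hz0, h0φ] at hvel₂
    -- the derivative of the equation of the chord
    have r1 := (hΓ₀.add ((lift d2).ofReal_comp.mul hvel)).unique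
      ((liftΓ d1 h0₁).congr_of_eventuallyEq (htend.eventually hchord |>.mono fun t ht => ht.symm))
    -- the derivative of the equation of the arc
    have r2 := ((liftΓ d1 h0₁).add ((hvel.sub hvel₂).const_mul (μ * Complex.I))).unique
      ((liftΓ d3 h0₂).congr_of_eventuallyEq (htend.eventually harc |>.mono fun t ht => by
        rw [larmorArc_eq] at ht; exact ht.symm))
    rw [hz0, h0ℓ] at r1
    have hlin := linearised_leg (θ₀ := phaseAngle z) hμ (norm_velocity hΩ _ _) hturn
      rfl h₁ h₂ hs₁.ne' hs₂.ne' (ℓ := e.chord)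
      r1.symm r2.symm
    -- the components of the derivative of the billiard map
    have hBl : HasDerivAt (fun t : ℝ => billiardMap Ω Γ L μ (z + t • h))
        (fderiv ℝ (billiardMap Ω Γ L μ) z h) 0 := by
      have h1 : HasFDerivAt (billiardMap Ω Γ L μ) (fderiv ℝ (billiardMap Ω Γ L μ) z)
          (z + (0 : ℝ) • h) := by rw [hz0]; exact hdiff.hasFDerivAt
      exact h1.comp_hasDerivAt 0 hl
    have hB1 : (fderiv ℝ (billiardMap Ω Γ L μ) z h).1 = fderiv ℝ S₂ z h := by
      refine ((ContinuousLinearMap.fst ℝ ℝ ℝ).hasFDerivAt.comp_hasDerivAt 0 hBl).unique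
        ((lift d3).congr_of_eventuallyEq ?_)
      exact (htend.eventually hB).mono fun t ht => by simp [ht]
    have hB2 : (fderiv ℝ (billiardMap Ω Γ L μ) z h).2 = Real.sin e.reentryAngle *
        (rotationRate Γ z h + fderiv ℝ φ z h -
          curvature Γ e.reentryParam * fderiv ℝ S₂ z h) := by
      have g1 : HasDerivAt (deriv Γ) (Complex.I * curvature Γ e.reentryParam *
          deriv Γ e.reentryParam) (S₂ (z + (0 : ℝ) • h)) := by
        rw [hz0, h0₂]; exact hΩ.hasDerivAt_deriv _
      have g2 := g1.scomp 0 (lift d3)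
      have g3 := Complex.conjCLE.hasFDerivAt.comp_hasDerivAt 0 g2
      have g4 := (Complex.reCLM.hasFDerivAt.comp_hasDerivAt 0 (g3.mul hvel₂)).neg
      have g5 := ((ContinuousLinearMap.snd ℝ ℝ ℝ).hasFDerivAt.comp_hasDerivAt 0 hBl).unique
        (g4.congr_of_eventuallyEq ((htend.eventually hB).mono fun t ht => by simp [ht]))
      rw [← reentry_rate (hΩ.unit_speed _) h₂]
      refine g5.trans ?_
      rw [← Complex.reCLM_apply]
      refine congrArg (fun c => -Complex.reCLM c) ?_
      simp only [Pi.mul_apply, Function.comp_apply, hz0, h0₂, h0φ]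
      rw [Complex.conjCLE_apply]
      refine congrArg₂ (· + ·) rfl ?_
      push_cast
      ring
    rw [hB1, hB2]
    refine ⟨hlin.1, ?_⟩
    rw [← hlin.2]
    field_simp
    ring
  have k1 := key (1, 0)
  have k2 := key (0, 1)
  simp only [rotationRate] at k1 k2
  ext i j
  fin_cases i <;> fin_cases j <;>
    simp [transversalFrame, halfTurnMatrix, jacobian, Matrix.mul_apply, Fin.sum_univ_two]
  · linear_combination -k1.1
  · linear_combination k2.1
  · linear_combination k1.2
  · linear_combination k2.2

/-! ### Two-periodic orbits -/

/-- A chord followed by a Larmor arc and again a chord followed by a Larmor arc, closing up together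
with the velocity: the chords are antiparallel and have the same length, and both arcs are half
circles, since the displacements along the two arcs cancel. -/
lemma closing_condition {ℓ ℓ' : ℝ} {v v' E E' p₀ p₁ p₂ p₃ : ℂ} (hℓ : 0 < ℓ) (hℓ' : 0 < ℓ')
    (hv : ‖v‖ = 1) (hv' : ‖v'‖ = 1) (hE : v' = E * v) (hE' : v = E' * v')
    (h₁ : p₁ = p₀ + ℓ * v) (h₂ : p₂ = p₁ + μ * Complex.I * (v - E * v))
    (h₃ : p₃ = p₂ + ℓ' * v') (h₀ : p₀ = p₃ + μ * Complex.I * (v' - E' * v')) :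
    ℓ' = ℓ ∧ v' = -v ∧ E = -1 ∧ E' = -1 := by
  have h : (ℓ' : ℂ) * v' = -(ℓ * v) := by
    rw [← hE] at h₂
    rw [← hE'] at h₀
    linear_combination -h₁ - h₂ - h₃ - h₀
  have h1 := congrArg norm h
  simp only [norm_mul, norm_neg, Complex.norm_real, hv, hv', mul_one, Real.norm_eq_abs,
    abs_of_pos hℓ, abs_of_pos hℓ'] at h1
  have hv0 : v ≠ 0 := fun h => by simp [h] at hv
  have hv0' : v' ≠ 0 := fun h => by simp [h] at hv'
  have hℓ0 : (ℓ : ℂ) ≠ 0 := by exact_mod_cast hℓ.ne'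
  have h2 : v' = -v := by
    rw [h1] at h
    apply mul_left_cancel₀ hℓ0
    linear_combination h
  refine ⟨h1, h2, mul_right_cancel₀ hv0 ?_, mul_right_cancel₀ hv0' ?_⟩
  · rw [← hE, h2, neg_one_mul]
  · rw [← hE', h2, neg_one_mul, neg_neg]

/-- At both ends of a half circle outside the table the angles are acute, by convexity: the
diameter joining its ends is a chord of the table, perpendicular to the velocities. -/
lemma IsLeg.cot_pos_of_half_turn (hΩ : IsStrictlyConvexTable Ω Γ L) (hμ : 0 < μ) {s θ : ℝ} {e : Leg}
    (he : IsLeg Ω Γ L μ s θ e) (hre : e.reentryAngle ∈ Ioo 0 Real.pi)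
    (hturn : Complex.exp (e.turn * Complex.I) = -1) :
    0 < Real.cot e.exitAngle ∧ 0 < Real.cot e.reentryAngle := by
  have hne := hΩ.ne_of_mem_Ioo he.reentry_mem
  have hP := he.reentry_eq
  have h₁ := eq_mul_exp_neg_angle (hΩ.unit_speed e.exitParam) (norm_velocity hΩ s θ)
    (he.exit_im_neg hΩ)
  have h₂ := eq_mul_exp_angle (hΩ.unit_speed e.reentryParam)
    (norm_reentryVelocity hΩ e.turn) (he.reentry_im_pos hΩ hμ hre)
  have hs₁ := Real.sin_pos_of_mem_Ioo ((angle_mem_Ioo_iff (hΩ.unit_speed e.exitParam)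
    (norm_velocity hΩ s θ)).2 (he.exit_im_neg hΩ).ne)
  have hs₂ := Real.sin_pos_of_mem_Ioo hre
  rw [← he.exitAngle_eq] at h₁ hs₁
  rw [← he.reentryAngle_eq] at h₂
  rw [larmorArc_eq, hturn] at hP
  rw [hturn] at h₂
  have hu : ∀ t, conj (deriv Γ t) * deriv Γ t = 1 := fun t => by
    rw [mul_comm, Complex.mul_conj, Complex.normSq_eq_norm_sq, hΩ.unit_speed]; simp
  have i₁ := hΩ.im_pos_of_ne hne
  have i₂ := hΩ.im_pos_of_ne hne.symm
  have r₁ : conj (deriv Γ e.exitParam) * (Γ e.reentryParam - Γ e.exitParam) =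
      ((2 * μ : ℝ) : ℂ) * (Complex.I * Complex.exp ((-e.exitAngle : ℝ) * Complex.I)) := by
    rw [hP, h₁]
    push_cast
    linear_combination (2 * μ * Complex.I * Complex.exp (-e.exitAngle * Complex.I)) *
      hu e.exitParam
  have r₂ : conj (deriv Γ e.reentryParam) * (Γ e.exitParam - Γ e.reentryParam) =
      ((2 * μ : ℝ) : ℂ) * (Complex.I * Complex.exp (e.reentryAngle * Complex.I)) := by
    push_cast
    linear_combination (2 * μ * Complex.I * Complex.exp (e.reentryAngle * Complex.I)) *
      hu e.reentryParam - conj (deriv Γ e.reentryParam) * hP +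
      conj (deriv Γ e.reentryParam) * (2 * μ * Complex.I) * h₂
  rw [r₁, Complex.im_ofReal_mul, Complex.I_mul_im, Complex.exp_ofReal_mul_I_re, Real.cos_neg] at i₁
  rw [r₂, Complex.im_ofReal_mul, Complex.I_mul_im, Complex.exp_ofReal_mul_I_re] at i₂
  have hμ2 : 0 < 2 * μ := by linarith
  rw [Real.cot_eq_cos_div_sin, Real.cot_eq_cos_div_sin]
  exact ⟨div_pos (pos_of_mul_pos_right i₁ hμ2.le) hs₁, div_pos (pos_of_mul_pos_right i₂ hμ2.le) hs₂⟩

/-- If `J`, `J'` are represented by `A`, `B` with respect to two invertible frames `N`, `N'`, then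
`J' * J` has the trace of `B * A`. -/
lemma trace_mul_of_frames {n : Type*} [Fintype n] [DecidableEq n] {N N' J J' A B : Matrix n n ℝ}
    (hN : IsUnit N.det) (hN' : IsUnit N'.det) (h : N' * J = A * N) (h' : N * J' = B * N') :
    (J' * J).trace = (B * A).trace := by
  have hJ : J = N'⁻¹ * (A * N) := by
    rw [← h, ← Matrix.mul_assoc, Matrix.nonsing_inv_mul _ hN', Matrix.one_mul]
  have hJ' : J' = N⁻¹ * (B * N') := by
    rw [← h', ← Matrix.mul_assoc, Matrix.nonsing_inv_mul _ hN, Matrix.one_mul]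
  have : J' * J = N⁻¹ * (B * A * N) := by
    rw [hJ, hJ']
    calc N⁻¹ * (B * N') * (N'⁻¹ * (A * N)) = N⁻¹ * (B * (N' * N'⁻¹) * A * N) := by
          simp only [Matrix.mul_assoc]
      _ = _ := by rw [Matrix.mul_nonsing_inv _ hN', Matrix.mul_one]
  rw [this, Matrix.trace_mul_comm, Matrix.mul_assoc, Matrix.mul_nonsing_inv _ hN, Matrix.mul_one]

lemma isUnit_det_transversalFrame {s θ : ℝ} (h : Real.sin θ ≠ 0) :
    IsUnit (transversalFrame Γ s θ).det := by
  rw [transversalFrame, Matrix.det_fin_two_of, isUnit_iff_ne_zero]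
  field_simp
  norm_num

lemma trace_halfTurnMatrix_mul (ℓ b c : ℝ) :
    (halfTurnMatrix ℓ b * halfTurnMatrix ℓ c).trace =
      2 - 2 * ℓ * (b + c) + ℓ ^ 2 * b * c := by
  simp [halfTurnMatrix, Matrix.trace_fin_two]
  ring

/-- The trace exceeds `2` beyond `2 / β + 2 / δ`, and is below `-2` exactly between `2 / β` and
`2 / δ`: it is `2 + α (α β δ - 2 (β + δ))` and also `-2 + (α β - 2) (α δ - 2)`. -/
lemma trace_trichotomy {α β δ m M t : ℝ} (hα : 0 < α) (hβ : 0 < β) (hδ : 0 < δ)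
    (hm : m = min (2 / β) (2 / δ)) (hM : M = max (2 / β) (2 / δ))
    (ht : t = 2 - 2 * α * (β + δ) + α ^ 2 * β * δ) :
    (|t| = 2 ↔ α = m ∨ α = M ∨ α = m + M) ∧
    (|t| < 2 ↔ α ∈ Ioo 0 m ∪ Ioo M (m + M)) ∧
    (2 < |t| ↔ α ∈ Ioo m M ∪ Ioi (m + M)) := by
  have hm0 : 0 < m := by rw [hm]; positivity
  have hmM : m ≤ M := by rw [hm, hM]; exact min_le_max
  have hsum : m + M = 2 / β + 2 / δ := by rw [hm, hM, min_add_max]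
  have hprod : m * M = 2 / β * (2 / δ) := by rw [hm, hM, min_mul_max]
  have e1 : t - 2 = β * δ * (α * (α - (m + M))) := by
    rw [hsum, ht]; field_simp; ring
  have e2 : t + 2 = β * δ * ((α - m) * (α - M)) := by
    have : (α - m) * (α - M) = α ^ 2 - (m + M) * α + m * M := by ring
    rw [this, hsum, hprod, ht]; field_simp; ring
  have hbd : 0 < β * δ := mul_pos hβ hδ
  have p1 : 0 < t - 2 ↔ m + M < α := by
    rw [e1, mul_pos_iff_of_pos_left hbd, mul_pos_iff_of_pos_left hα, sub_pos]
  have p2 : t - 2 = 0 ↔ α = m + M := by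
    rw [e1, mul_eq_zero_iff_left hbd.ne', mul_eq_zero_iff_left hα.ne', sub_eq_zero]
  have p3 : t + 2 < 0 ↔ m < α ∧ α < M := by
    rw [e2, ← neg_pos, ← mul_neg, mul_pos_iff_of_pos_left hbd, neg_pos, mul_neg_iff]
    constructor
    · rintro (⟨h1, h2⟩ | ⟨h1, h2⟩)
      · exact ⟨by linarith, by linarith⟩
      · linarith
    · rintro ⟨h1, h2⟩
      exact Or.inl ⟨by linarith, by linarith⟩
  have p4 : t + 2 = 0 ↔ α = m ∨ α = M := by
    rw [e2, mul_eq_zero_iff_left hbd.ne', mul_eq_zero, sub_eq_zero, sub_eq_zero]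
  have hyp : 2 < |t| ↔ α ∈ Ioo m M ∪ Ioi (m + M) := by
    rw [lt_abs, mem_union, mem_Ioo, mem_Ioi, ← p3, ← p1]
    constructor
    · rintro (h | h)
      · exact Or.inr (by linarith)
      · exact Or.inl (by linarith)
    · rintro (h | h)
      · exact Or.inr (by linarith)
      · exact Or.inl (by linarith)
  have par : |t| = 2 ↔ α = m ∨ α = M ∨ α = m + M := by
    rw [← or_assoc, ← p4, ← p2, abs_eq (by norm_num)]
    constructor
    · rintro (h | h)
      · exact Or.inr (by linarith)
      · exact Or.inl (by linarith)
    · rintro (h | h)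
      · exact Or.inr (by linarith)
      · exact Or.inl (by linarith)
  refine ⟨par, ?_, hyp⟩
  have hlt : |t| < 2 ↔ ¬ |t| = 2 ∧ ¬ 2 < |t| := by
    constructor
    · intro h
      exact ⟨h.ne, h.le.not_gt⟩
    · rintro ⟨h1, h2⟩
      exact lt_of_le_of_ne (not_lt.1 h2) h1
  rw [hlt, par, hyp]
  simp only [mem_union, mem_Ioo, mem_Ioi]
  constructor
  · rintro ⟨h1, h2⟩
    push Not at h1 h2
    rcases lt_trichotomy α m with h | h | h
    · exact Or.inl ⟨hα, h⟩
    · exact absurd h h1.1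
    · exact Or.inr ⟨lt_of_le_of_ne (h2.1 h) h1.2.1.symm, lt_of_le_of_ne h2.2 h1.2.2⟩
  · rintro (⟨h1, h2⟩ | ⟨h1, h2⟩)
    · refine ⟨?_, ?_⟩
      · rintro (h | h | h) <;> linarith
      · rintro (⟨h, h'⟩ | h) <;> linarith
    · refine ⟨?_, ?_⟩
      · rintro (h | h | h) <;> linarith
      · rintro (⟨h, h'⟩ | h) <;> linarith

/-- The two legs of an orbit of least period two: each is a genuine leg, re-enters transversally
and turns through a half circle, and they have the same chord length. The second one returns to the
boundary point and to the angle at which the first one started. -/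
lemma IsPeriodic.exists_legs (hΩ : IsStrictlyConvexTable Ω Γ L) (hμ : 0 < μ) {z : ℝ × ℝ}
    (hz : IsPeriodic Ω Γ L μ 2 z) :
    ∃ e e' : Leg, IsLeg Ω Γ L μ z.1 (phaseAngle z) e ∧
      IsLeg Ω Γ L μ (billiardMap Ω Γ L μ z).1 (phaseAngle (billiardMap Ω Γ L μ z)) e' ∧
      e.reentryAngle ∈ Ioo 0 Real.pi ∧ e'.reentryAngle ∈ Ioo 0 Real.pi ∧
      (billiardMap Ω Γ L μ z).1 = e.reentryParam ∧
      phaseAngle (billiardMap Ω Γ L μ z) = e.reentryAngle ∧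
      phaseAngle z = e'.reentryAngle ∧
      (∃ k : ℤ, e'.reentryParam = z.1 + k * L) ∧
      e'.chord = e.chord ∧
      Complex.exp (e.turn * Complex.I) = -1 ∧ Complex.exp (e'.turn * Complex.I) = -1 := by
  obtain ⟨hz1, -, ⟨⟨k, hk⟩, hu⟩, hmin⟩ := hz
  have hmin1 := hmin 1 one_pos (by norm_num)
  simp only [Function.iterate_succ, Function.iterate_zero, Function.comp, id] at hk hu hmin1
  set w := billiardMap Ω Γ L μ z with hw
  have hne : w ≠ z := fun h => hmin1 (by rw [h]; exact ⟨⟨0, by simp⟩, rfl⟩)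
  have hne' : billiardMap Ω Γ L μ w ≠ w := fun h =>
    hmin1 ⟨⟨k, by rw [← hk, h]⟩, by rw [← hu, h]⟩
  have he := isLeg_leg_of_ne hne
  have he' := isLeg_leg_of_ne hne'
  set e := leg Ω Γ L μ z
  set e' := leg Ω Γ L μ w
  have hwe : w = (e.reentryParam, -Real.cos e.reentryAngle) := hw.trans (billiardMap_eq hΩ he)
  have hwe' : billiardMap Ω Γ L μ w = (e'.reentryParam, -Real.cos e'.reentryAngle) :=
    billiardMap_eq hΩ he'
  rw [hwe'] at hk hu
  simp only at hk hu
  have hacos : ∀ {s θ : ℝ} {e : Leg}, IsLeg Ω Γ L μ s θ e →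
      Real.arccos (Real.cos e.reentryAngle) = e.reentryAngle := fun {s θ e} he => by
    rw [he.reentryAngle_eq]
    exact Real.arccos_cos (InnerProductGeometry.angle_nonneg _ _)
      (InnerProductGeometry.angle_le_pi _ _)
  have hre' : e'.reentryAngle ∈ Ioo 0 Real.pi :=
    he'.reentryAngle_mem_Ioo_iff.2 (by rw [hu]; exact hz1)
  have hre : e.reentryAngle ∈ Ioo 0 Real.pi := by
    refine he.reentryAngle_mem_Ioo_iff.2 ?_
    have := phaseAngle_mem_Ioo_iff.1 he'.angle_mem
    rwa [hwe] at this
  have hang : phaseAngle w = e.reentryAngle := by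
    rw [phaseAngle, hwe]
    simp only [neg_neg]
    exact hacos he
  have hang' : phaseAngle z = e'.reentryAngle := by
    rw [phaseAngle, ← hu, neg_neg]
    exact hacos he'
  -- the re-entry velocity of each leg is the initial velocity of the other one
  have hv : velocity Γ w.1 (phaseAngle w) =
      Complex.exp (e.turn * Complex.I) * velocity Γ z.1 (phaseAngle z) := by
    rw [eq_mul_exp_angle (hΩ.unit_speed e.reentryParam) (IsLeg.norm_reentryVelocity hΩ e.turn)
      (he.reentry_im_pos hΩ hμ hre), ← he.reentryAngle_eq, hang, velocity, hwe]
  have hper : Γ e'.reentryParam = Γ z.1 := by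
    rw [hk]; simpa using hΩ.periodic.int_mul k z.1
  have hper' : deriv Γ e'.reentryParam = deriv Γ z.1 := by
    rw [hk]; simpa using hΩ.deriv_periodic.int_mul k z.1
  have hv' : velocity Γ z.1 (phaseAngle z) =
      Complex.exp (e'.turn * Complex.I) * velocity Γ w.1 (phaseAngle w) := by
    rw [eq_mul_exp_angle (hΩ.unit_speed e'.reentryParam) (IsLeg.norm_reentryVelocity hΩ e'.turn)
      (he'.reentry_im_pos hΩ hμ hre'), ← he'.reentryAngle_eq, hang', velocity, hper']
  have h₂ := he.reentry_eq
  have h₀ := he'.reentry_eq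
  rw [larmorArc_eq] at h₂ h₀
  rw [hper] at h₀
  have hw1 : w.1 = e.reentryParam := by rw [hwe]
  obtain ⟨c1, -, c3, c4⟩ := closing_condition he.chord_pos he'.chord_pos (norm_velocity hΩ _ _)
    (norm_velocity hΩ _ _) hv hv' he.exit_eq h₂ (by rw [he'.exit_eq, hw1]) h₀
  exact ⟨e, e', he, he', hre, hre', hw1, hang, hang', ⟨k, hk⟩, c1, c3, c4⟩

end InverseMagnetic
end

theorem mainTheorem1 (Ω : Set ℂ) (Γ : ℝ → ℂ) (L μ : ℝ)
    (hΩ : InverseMagnetic.IsStrictlyConvexTable Ω Γ L) (hμ : 0 < μ)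
    (z₀ z₂ : ℝ × ℝ) (hz₀ : InverseMagnetic.IsPeriodic Ω Γ L μ 2 z₀)
    (hz₂ : z₂ = InverseMagnetic.billiardMap Ω Γ L μ z₀)
    (ℓ₁ θ₀ θ₁ θ₂ θ₃ α β δ m M : ℝ)
    (hℓ₁ : ℓ₁ = (InverseMagnetic.leg Ω Γ L μ z₀).chord)
    (hθ₀ : θ₀ = InverseMagnetic.phaseAngle z₀)
    (hθ₁ : θ₁ = (InverseMagnetic.leg Ω Γ L μ z₀).exitAngle)
    (hθ₂ : θ₂ = InverseMagnetic.phaseAngle z₂)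
    (hθ₃ : θ₃ = (InverseMagnetic.leg Ω Γ L μ z₂).exitAngle)
    (hα : α = ℓ₁ / μ)
    (hβ : β = Real.cot θ₀ + Real.cot θ₃)
    (hδ : δ = Real.cot θ₁ + Real.cot θ₂)
    (hm : m = min (2 / β) (2 / δ))
    (hM : M = max (2 / β) (2 / δ)) :
    DifferentiableAt ℝ (InverseMagnetic.billiardMap Ω Γ L μ) z₀ ∧
    DifferentiableAt ℝ (InverseMagnetic.billiardMap Ω Γ L μ) z₂ ∧
    0 < α ∧ 0 < β ∧ 0 < δ ∧
    (InverseMagnetic.stabilityMatrix Ω Γ L μ 2 z₀).trace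
      = 2 - 2 * α * (β + δ) + α ^ 2 * β * δ ∧
    (β ≠ δ →
      (InverseMagnetic.IsParabolic Ω Γ L μ 2 z₀ ↔ α = m ∨ α = M ∨ α = m + M) ∧
      (InverseMagnetic.IsElliptic Ω Γ L μ 2 z₀ ↔
        α ∈ Set.Ioo 0 m ∪ Set.Ioo M (m + M)) ∧
      (InverseMagnetic.IsHyperbolic Ω Γ L μ 2 z₀ ↔
        α ∈ Set.Ioo m M ∪ Set.Ioi (m + M))) ∧
    (β = δ →
      m = M ∧
      (InverseMagnetic.IsParabolic Ω Γ L μ 2 z₀ ↔ α = m ∨ α = 2 * m) ∧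
      (InverseMagnetic.IsElliptic Ω Γ L μ 2 z₀ ↔
        α ∈ Set.Ioo 0 m ∪ Set.Ioo m (2 * m)) ∧
      (InverseMagnetic.IsHyperbolic Ω Γ L μ 2 z₀ ↔ α ∈ Set.Ioi (2 * m))) := by
  obtain ⟨e, e', he, he', hre, hre', hw1, hang, hang', ⟨k, hk⟩, hch, ht, ht'⟩ :=
    hz₀.exists_legs hΩ hμ
  rw [← hz₂] at he' hw1 hang
  rw [InverseMagnetic.leg_eq hΩ he] at hℓ₁ hθ₁
  rw [InverseMagnetic.leg_eq hΩ he'] at hθ₃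
  rw [hang'] at hθ₀
  rw [hang] at hθ₂
  obtain ⟨d₀, f₀⟩ :=
    InverseMagnetic.differentiableAt_and_transversalFrame_mul_jacobian hΩ hμ he hre ht
  obtain ⟨d₂, f₂⟩ :=
    InverseMagnetic.differentiableAt_and_transversalFrame_mul_jacobian hΩ hμ he' hre' ht'
  obtain ⟨p₁, p₂⟩ := he.cot_pos_of_half_turn hΩ hμ hre ht
  obtain ⟨p₃, p₀⟩ := he'.cot_pos_of_half_turn hΩ hμ hre' ht'
  have hβ0 : 0 < β := by rw [hβ, hθ₀, hθ₃]; exact add_pos p₀ p₃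
  have hδ0 : 0 < δ := by rw [hδ, hθ₁, hθ₂]; exact add_pos p₁ p₂
  have hα0 : 0 < α := by rw [hα, hℓ₁]; exact div_pos he.chord_pos hμ
  -- the frame at the end of the second leg is the frame at the start of the first one
  have hframe : InverseMagnetic.transversalFrame Γ e'.reentryParam e'.reentryAngle =
      InverseMagnetic.transversalFrame Γ z₀.1 (InverseMagnetic.phaseAngle z₀) := by
    have hper : deriv Γ e'.reentryParam = deriv Γ z₀.1 := by
      rw [hk]; simpa using hΩ.deriv_periodic.int_mul k z₀.1
    have hper' : deriv (deriv Γ) e'.reentryParam = deriv (deriv Γ) z₀.1 := by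
      have h : Function.Periodic (deriv (deriv Γ)) L := fun s => by
        rw [← deriv_comp_add_const]
        exact congrArg (fun f => deriv f s) (funext hΩ.deriv_periodic)
      rw [hk]; simpa using h.int_mul k z₀.1
    rw [hang', InverseMagnetic.transversalFrame, InverseMagnetic.transversalFrame,
      InverseMagnetic.curvature, InverseMagnetic.curvature, hper, hper']
  rw [hframe, hch, hw1, hang] at f₂
  have htr : (InverseMagnetic.stabilityMatrix Ω Γ L μ 2 z₀).trace
      = 2 - 2 * α * (β + δ) + α ^ 2 * β * δ := by
    have hS : InverseMagnetic.stabilityMatrix Ω Γ L μ 2 z₀ =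
        InverseMagnetic.jacobian Ω Γ L μ z₂ * InverseMagnetic.jacobian Ω Γ L μ z₀ := by
      simp [InverseMagnetic.stabilityMatrix, hz₂]
    rw [hS, InverseMagnetic.trace_mul_of_frames
      (InverseMagnetic.isUnit_det_transversalFrame (Real.sin_pos_of_mem_Ioo he.angle_mem).ne')
      (InverseMagnetic.isUnit_det_transversalFrame (Real.sin_pos_of_mem_Ioo hre).ne') f₀ f₂,
      InverseMagnetic.trace_halfTurnMatrix_mul, hα, hβ, hδ, hθ₀, hθ₁, hθ₂, hθ₃, hℓ₁]
    field_simp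
    ring
  obtain ⟨hpar, hell, hhyp⟩ := InverseMagnetic.trace_trichotomy hα0 hβ0 hδ0 hm hM htr
  refine ⟨d₀, d₂, hα0, hβ0, hδ0, htr, fun _ => ⟨hpar, hell, hhyp⟩, fun h => ?_⟩
  have hmM : m = M := by rw [hm, hM, h, min_self, max_self]
  rw [← hmM, ← two_mul] at hpar hell hhyp
  refine ⟨hmM, hpar.trans ?_, hell, hhyp.trans ?_⟩
  · rw [← or_assoc, or_self]
  · rw [Set.Ioo_self, Set.empty_union]
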